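/- Let $n\ge 1$, $I=\{-n,\dots,-1,1,\dots,n\}$ with parity $|i|=\bar 0$ for $i>0$ and $|i|=\bar 1$ for $i<0$, and let $\Bbbk=\mathbb{C}((q))$. Let $V_q$ be the $\Bbbk$-superspace with basis $v_i$ ($i\in I$) of parity $|i|$, with matrix units $E_{ij}\in\mathrm{End}(V_q)$ of parity $|i|+|j|$. Put $\xi=q-q^{-1}$, $\varphi(i,j)=(-1)^{|j|}(\delta_{i,j}+\delta_{i,-j})$ and $$S=\sum_{i,j\in I}q^{\varphi(i,j)}E_{ii}\otimes E_{jj}+\xi\sum_{i<j}(-1)^{|i|}(E_{ji}+E_{-j,-i})\otimes E_{ij}.$$ All tensor products of superalgebras carry the Koszul-signed multiplication $(x\otimes y)(x'\otimes y')=(-1)^{|y||x'|}xx'\otimes yy'$. Let $U=\mathrm{U}_q(\mathfrak{q}_n)$ be the unital associative $\Bbbk$-superalgebra with generators $L_{ij}$ ($i\le j$ in $I$) of parity $|i|+|j|$ and relations $L_{ii}L_{-i,-i}=1=L_{-i,-i}L_{ii}$ and $L^{12}L^{13}S^{23}=S^{23}L^{13}L^{12}$ in $U\otimes\mathrm{End}(V_q)^{\otimes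 2}$, where $L=\sum_{i\le j}L_{ij}\otimes E_{ij}$. It has the comultiplication $\Delta(L_{ij})=\sum_{i\le k\le j}(-1)^{(|i|+|k|)(|k|+|j|)}L_{ik}\otimes L_{kj}$ and the counit $\varepsilon(L_{ij})=\delta_{ij}$. The finite dual $U^\circ$ is the space of all $f\in U^*$ whose kernel contains a two-sided $\mathbb{Z}_2$-graded ideal of $U$ of finite codimension; $f\in U^\circ$ is homogeneous of parity $p$ if it vanishes on the elements of parity $p+\bar 1$. With the pairing $\langle f\otimes g,x\otimes y\rangle=(-1)^{|g||x|}\langle f,x\rangle\langle g,y\rangle$ for homogeneous elements, $U^\circ$ has the multiplication $\langle fg,x\rangle=\langle f\otimes g,\Delta(x)\rangle$, the unit $\varepsilon$, the comultiplication $\Delta^\circ:U^\circ\to U^\circ\otimes U^\circ$ determined by $\langle\Delta^\circ(f),x\otimes y\rangle=\langle f,xy\rangle$, and the counit $\epsilon^\circ(f)=f(1)$. The superspace $V_q$ is a $U$-supermodule on which $L$ acts by $S$, i.e. $L_{ij}$ acts by $\sum_{a,b}s_{ab,ij}E_{ab}$, where $S=\sum s_{ab,ij}E_{ab}\otimes E_{ij}$.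 Let $t_{ab}\in U^\circ$ ($a,b\in I$) be its matrix elements: $x.v_b=\sum_{a\in I}\langle t_{ab},x\rangle v_a$ for $x\in U$. Let $\mathcal{A}_q(\mathfrak{q}_n)$ be the (unital) sub-superalgebra of $U^\circ$ generated by all $t_{ab}$, and $T=\sum_{a,b\in I}E_{ab}\otimes t_{ab}\in\mathrm{End}(V_q)\otimes\mathcal{A}_q(\mathfrak{q}_n)$. **Proposition.** $U^\circ$ is a bi-superalgebra and $\mathcal{A}_q(\mathfrak{q}_n)$ is a sub-bi-superalgebra of it; that is, $\mathcal{A}_q(\mathfrak{q}_n)$ is a $\mathbb{Z}_2$-graded unital subalgebra with $\Delta^\circ(\mathcal{A}_q(\mathfrak{q}_n))\subseteq\mathcal{A}_q(\mathfrak{q}_n)\otimes\mathcal{A}_q(\mathfrak{q}_n)$. The element $t_{ab}$ has parity $|a|+|b|$, and the generators satisfy $$t_{ab}=t_{-a,-b}\quad(a,b\in I),\qquad S^{12}T^{13}T^{23}=T^{23}T^{13}S^{12}\ \text{ in }\ \mathrm{End}(V_q)^{\otimes 2}\otimes\mathcal{A}_q(\mathfrak{q}_n),$$ $$\Delta^\circ(t_{ab})=\sum_{c\in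 I}(-1)^{(|a|+|c|)(|c|+|b|)}\,t_{ac}\otimes t_{cb}\quad(a,b\in I).$$ Equivalently to the last formula, $\langle t_{ab},xy\rangle=\sum_{c\in I}\langle t_{ac},x\rangle\langle t_{cb},y\rangle$ for all $x,y\in U$. -/

import Mathlib

open scoped TensorProduct

namespace QueerSuper

/-- The base field `ℂ((q))` of formal Laurent series. -/
def K : Type := LaurentSeries ℂ

noncomputable instance : Field K := inferInstanceAs (Field (LaurentSeries ℂ))

/-- The indeterminate `q`. -/
noncomputable def q : K := (HahnSeries.single 1 1 : LaurentSeries ℂ)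

/-- `ξ = q - q⁻¹`. -/
noncomputable def xi : K := q - q⁻¹

/-- The sign `(-1)^p` of a parity `p`. -/
noncomputable def sgn (p : ZMod 2) : K := (-1) ^ p.val

/-- The index set `I_{n|n} = {-n, …, -1, 1, …, n}`. -/
abbrev Idx (n : ℕ) : Type := {i : ℤ // i ∈ (Finset.Icc (-(n : ℤ)) n).erase 0}

instance (n : ℕ) : Neg (Idx n) :=
  ⟨fun i => ⟨-i.1, by have h := i.2; simp only [Finset.mem_erase, Finset.mem_Icc] at h ⊢; omega⟩⟩

/-- The parity `|i|` of an index. -/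
def par {n : ℕ} (i : Idx n) : ZMod 2 := if 0 < i.1 then 0 else 1

/-- The exponent `φ(i,j) = (-1)^{|j|} (δ_{i,j} + δ_{i,-j})`. -/
def phi {n : ℕ} (i j : Idx n) : ℤ :=
  (-1) ^ (par j).val * ((if i = j then 1 else 0) + (if i = -j then 1 else 0))

/-- `Smat a b c d` is the coefficient of `E_{ab} ⊗ E_{cd}` in
`S = ∑_{i,j} q^{φ(i,j)} E_{ii} ⊗ E_{jj} + ξ ∑_{i<j} (-1)^{|i|} (E_{ji} + E_{-j,-i}) ⊗ E_{ij}`. -/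
noncomputable def Smat {n : ℕ} (a b c d : Idx n) : K :=
  (if a = b ∧ c = d then q ^ phi a c else 0) +
  (if c < d then
    xi * sgn (par c) *
      ((if a = d ∧ b = c then 1 else 0) + (if a = -d ∧ b = -c then 1 else 0)) else 0)

/-! ### Basic facts on signs -/

theorem q_ne_zero : q ≠ 0 :=
  HahnSeries.single_ne_zero (Γ := ℤ) (R := ℂ) (a := 1) (r := 1) one_ne_zero

theorem K_two_ne_zero : (2 : K) ≠ 0 := by
  have h := (algebraMap ℂ (LaurentSeries ℂ)).injective.ne (two_ne_zero (α := ℂ))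
  rw [map_ofNat, map_zero] at h
  exact h

theorem zmod2_cases (p : ZMod 2) : p = 0 ∨ p = 1 := by
  revert p; decide

@[simp] theorem sgn_zero : sgn 0 = 1 := by simp [sgn]

@[simp] theorem sgn_one : sgn 1 = -1 := by simp [sgn, ZMod.val_one]

theorem sgn_add (p r : ZMod 2) : sgn (p + r) = sgn p * sgn r := by
  rcases zmod2_cases p with rfl | rfl <;> rcases zmod2_cases r with rfl | rfl <;>
    simp only [sgn_zero, sgn_one, add_zero, zero_add, one_mul, mul_one,
      show (1 + 1 : ZMod 2) = 0 from rfl]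
  ring

@[simp] theorem sgn_mul_self (p : ZMod 2) : sgn p * sgn p = 1 := by
  rw [← sgn_add, CharTwo.add_self_eq_zero, sgn_zero]

@[simp] theorem neg_val {n : ℕ} (i : Idx n) : (-i).1 = -i.1 := rfl

theorem idx_ne_zero {n : ℕ} (i : Idx n) : i.1 ≠ 0 := (Finset.mem_erase.1 i.2).1

theorem par_neg {n : ℕ} (i : Idx n) : par (-i) = par i + 1 := by
  have := idx_ne_zero i
  unfold par
  rcases lt_or_gt_of_ne this with h | h
  · rw [if_pos (by simp; omega), if_neg (by omega)]; rfl
  · rw [if_neg (by simp; omega), if_pos (by omega)]; rfl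

/-- `S` is even. -/
theorem Smat_even {n : ℕ} (a b c d : Idx n) (h : par a + par b + (par c + par d) ≠ 0) :
    Smat a b c d = 0 := by
  unfold Smat
  rw [if_neg, zero_add]
  · split_ifs with h1 h2 h3 h3
    · obtain ⟨rfl, rfl⟩ := h2
      exact absurd (by rw [add_comm (par a), CharTwo.add_self_eq_zero]) h
    · obtain ⟨rfl, rfl⟩ := h2
      exact absurd (by rw [add_comm (par a), CharTwo.add_self_eq_zero]) h
    · obtain ⟨rfl, rfl⟩ := h3
      refine absurd ?_ h
      rw [par_neg, par_neg]
      generalize par c = x, par d = y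
      revert x y; decide
    · simp
    · rfl
  · rintro ⟨rfl, rfl⟩
    exact h (by rw [CharTwo.add_self_eq_zero, CharTwo.add_self_eq_zero, add_zero])

/-! ### Superspaces

A superspace over `K` is given by its parity involution `γ`, acting by `(-1)^p` on the part of
parity `p`. -/

section Superspace

variable {M N : Type*} [AddCommGroup M] [Module K M] [AddCommGroup N] [Module K N]

/-- The subspace of vectors of parity `p`. -/
noncomputable def parityPart (γ : M →ₗ[K] M) (p : ZMod 2) : Submodule K M :=
  LinearMap.ker (γ - sgn p • LinearMap.id)

/-- The projection to the vectors of parity `p`. -/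
noncomputable def parityProj (γ : M →ₗ[K] M) (p : ZMod 2) : M →ₗ[K] M :=
  (2⁻¹ : K) • (LinearMap.id + sgn p • γ)

/-- The Koszul sign operator `x ⊗ y ↦ (-1)^{|x||y|} x ⊗ y`. -/
noncomputable def koszul (γ : M →ₗ[K] M) (γ' : N →ₗ[K] N) : M ⊗[K] N →ₗ[K] M ⊗[K] N :=
  ∑ p : ZMod 2, ∑ r : ZMod 2,
    sgn (p * r) • TensorProduct.map (parityProj γ p) (parityProj γ' r)

theorem mem_parityPart {γ : M →ₗ[K] M} {p : ZMod 2} {x : M} :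
    x ∈ parityPart γ p ↔ γ x = sgn p • x := by
  simp [parityPart, sub_eq_zero]

theorem parityProj_apply (γ : M →ₗ[K] M) (p : ZMod 2) (x : M) :
    parityProj γ p x = (2⁻¹ : K) • (x + sgn p • γ x) := rfl

theorem parityProj_mem (γ : M →ₗ[K] M) (h : ∀ x, γ (γ x) = x) (p : ZMod 2) (x : M) :
    parityProj γ p x ∈ parityPart γ p := by
  rw [mem_parityPart, parityProj_apply, map_smul, map_add, map_smul, h, smul_comm (sgn p),
    smul_add (sgn p), smul_smul (sgn p), sgn_mul_self, one_smul, add_comm]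

theorem parityProj_add (γ : M →ₗ[K] M) (x : M) :
    parityProj γ 0 x + parityProj γ 1 x = x := by
  simp only [parityProj_apply, sgn_zero, sgn_one, ← smul_add]
  have : x + (1 : K) • γ x + (x + (-1 : K) • γ x) = (2 : K) • x := by
    rw [two_smul]; simp; abel
  rw [this, smul_smul, inv_mul_cancel₀ K_two_ne_zero, one_smul]

theorem parityProj_of_mem (γ : M →ₗ[K] M) {p r : ZMod 2} {x : M} (hx : x ∈ parityPart γ p) :
    parityProj γ r x = if r = p then x else 0 := by
  rw [mem_parityPart] at hx
  rw [parityProj_apply, hx, smul_smul, ← sgn_add]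
  rcases zmod2_cases p with rfl | rfl <;> rcases zmod2_cases r with rfl | rfl <;>
    simp [← two_smul K x, smul_smul, inv_mul_cancel₀ K_two_ne_zero, show (1 + 1 : ZMod 2) = 0 from rfl]

theorem sum_zmod2 {G : Type*} [AddCommMonoid G] (f : ZMod 2 → G) : ∑ p, f p = f 0 + f 1 :=
  Fin.sum_univ_two f

theorem koszul_tmul (γ : M →ₗ[K] M) (γ' : N →ₗ[K] N) {p r : ZMod 2} {x : M} {y : N}
    (hx : x ∈ parityPart γ p) (hy : y ∈ parityPart γ' r) :
    koszul γ γ' (x ⊗ₜ y) = sgn (p * r) • (x ⊗ₜ[K] y) := by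
  simp only [koszul, LinearMap.sum_apply, LinearMap.smul_apply, TensorProduct.map_tmul,
    parityProj_of_mem γ hx, parityProj_of_mem γ' hy]
  rw [Finset.sum_eq_single p, Finset.sum_eq_single r]
  · simp
  · intro b _ hb; simp [hb]
  · simp
  · intro b _ hb; simp [hb]
  · simp

end Superspace

/-! ### The quantum queer superalgebra -/

/-- Index set of the generators `L_{ij}`, `i ≤ j`. -/
abbrev Gen (n : ℕ) : Type := {p : Idx n × Idx n // p.1 ≤ p.2}

/-- The letter `L_{ij}` of the free algebra, with the convention `L_{ij} = 0` for `i > j`. -/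
noncomputable def letter {n : ℕ} (i j : Idx n) : FreeAlgebra K (Gen n) :=
  if h : i ≤ j then FreeAlgebra.ι K ⟨(i, j), h⟩ else 0

/-- The coefficient of `E_{aj} ⊗ E_{cl}` in `L¹² L¹³ S²³`, computed in the tensor product of
superalgebras `U ⊗ End V ⊗ End V`, for a family `X` of elements `X i j` of parity `|i| + |j|` in
place of `L_{ij}`:  `X¹² X¹³ = ∑ (-1)^{|E_{ab}||X_{cd}|} X_{ab} X_{cd} ⊗ E_{ab} ⊗ E_{cd}` and
`(E_{ab} ⊗ E_{cd}) (E_{bj} ⊗ E_{dl}) = (-1)^{|E_{cd}||E_{bj}|} E_{aj} ⊗ E_{cl}`. -/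
noncomputable def relLeft {n : ℕ} {A : Type*} [Ring A] [Algebra K A] (X : Idx n → Idx n → A)
    (a j c l : Idx n) : A :=
  ∑ b, ∑ d, (sgn ((par a + par b) * (par c + par d)) * sgn ((par c + par d) * (par b + par j)) *
    Smat b j d l) • (X a b * X c d)

/-- The coefficient of `E_{aj} ⊗ E_{cl}` in `S²³ L¹³ L¹²`:
`X¹³ X¹² = ∑ X_{dl} X_{bj} ⊗ E_{bj} ⊗ E_{dl}` and
`(E_{ab} ⊗ E_{cd}) (E_{bj} ⊗ E_{dl}) = (-1)^{|E_{cd}||E_{bj}|} E_{aj} ⊗ E_{cl}`. -/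
noncomputable def relRight {n : ℕ} {A : Type*} [Ring A] [Algebra K A] (X : Idx n → Idx n → A)
    (a j c l : Idx n) : A :=
  ∑ b, ∑ d, (sgn ((par c + par d) * (par b + par j)) * Smat a b c d) • (X d l * X b j)

/-- The defining relations of `U_q(q_n)`: `L_{ii} L_{-i,-i} = 1` (for `i` of either sign) and
`L¹² L¹³ S²³ = S²³ L¹³ L¹²`. -/
inductive Rel (n : ℕ) : FreeAlgebra K (Gen n) → FreeAlgebra K (Gen n) → Prop
  | inv (i : Idx n) : Rel n (letter i i * letter (-i) (-i)) 1
  | rll (a j c l : Idx n) : Rel n (relLeft letter a j c l) (relRight letter a j c l)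

/-- The quantum queer superalgebra `U_q(q_n)`, as an algebra. -/
def U (n : ℕ) : Type := RingQuot (Rel n)

noncomputable instance (n : ℕ) : Ring (U n) := inferInstanceAs (Ring (RingQuot (Rel n)))
noncomputable instance (n : ℕ) : Algebra K (U n) := inferInstanceAs (Algebra K (RingQuot (Rel n)))

/-- The elements `L_{ij}` of `U_q(q_n)` (zero for `i > j`). -/
noncomputable def L {n : ℕ} (i j : Idx n) : U n := RingQuot.mkAlgHom K (Rel n) (letter i j)

theorem L_of_not_le {n : ℕ} {i j : Idx n} (h : ¬ i ≤ j) : L i j = 0 := by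
  rw [L, letter, dif_neg h]
  exact map_zero _

/-- The algebra homomorphism out of `U_q(q_n)` given by a family satisfying the relations. -/
noncomputable def U.lift {n : ℕ} {A : Type*} [Ring A] [Algebra K A] (X : Idx n → Idx n → A)
    (h0 : ∀ i j, ¬ i ≤ j → X i j = 0) (h1 : ∀ i, X i i * X (-i) (-i) = 1)
    (h2 : ∀ a j c l, relLeft X a j c l = relRight X a j c l) : U n →ₐ[K] A :=
  RingQuot.liftAlgHom K ⟨FreeAlgebra.lift K fun p : Gen n => X p.1.1 p.1.2, by
    have key : ∀ i j, FreeAlgebra.lift K (fun p : Gen n => X p.1.1 p.1.2) (letter i j) = X i j := by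
      intro i j
      by_cases h : i ≤ j
      · rw [letter, dif_pos h, FreeAlgebra.lift_ι_apply]
      · rw [letter, dif_neg h, map_zero, h0 i j h]
    rintro _ _ (⟨i⟩ | ⟨a, j, c, l⟩)
    · rw [map_mul, key, key, h1, map_one]
    · have := h2 a j c l
      simp only [relLeft, relRight, map_sum, map_smul, map_mul, key] at this ⊢
      exact this⟩

theorem U.lift_L {n : ℕ} {A : Type*} [Ring A] [Algebra K A] (X : Idx n → Idx n → A)
    (h0 : ∀ i j, ¬ i ≤ j → X i j = 0) (h1 : ∀ i, X i i * X (-i) (-i) = 1)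
    (h2 : ∀ a j c l, relLeft X a j c l = relRight X a j c l) (i j : Idx n) :
    U.lift X h0 h1 h2 (L i j) = X i j := by
  unfold U.lift L
  erw [RingQuot.liftAlgHom_mkAlgHom_apply]
  by_cases h : i ≤ j
  · rw [letter, dif_pos h, FreeAlgebra.lift_ι_apply]
  · rw [letter, dif_neg h, map_zero, h0 i j h]

theorem U.hom_ext {n : ℕ} {A : Type*} [Ring A] [Algebra K A] {f g : U n →ₐ[K] A}
    (h : ∀ i j, f (L i j) = g (L i j)) : f = g := by
  apply RingQuot.ringQuot_ext'
  apply FreeAlgebra.hom_ext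
  funext ⟨⟨i, j⟩, hij⟩
  have := h i j
  simp only [L, letter, dif_pos (show i ≤ j from hij)] at this
  exact this

theorem L_inv {n : ℕ} (i : Idx n) : L i i * L (-i) (-i) = 1 := by
  have := RingQuot.mkAlgHom_rel K (Rel.inv i)
  rwa [map_mul, map_one] at this

theorem L_rll {n : ℕ} (a j c l : Idx n) : relLeft L a j c l = relRight L a j c l := by
  have := RingQuot.mkAlgHom_rel K (Rel.rll a j c l)
  simp only [relLeft, relRight, map_sum, map_smul, map_mul] at this ⊢
  exact this

/-! ### The grading -/

/-- The parity automorphism of `U_q(q_n)`, with `L_{ij} ↦ (-1)^{|i|+|j|} L_{ij}`. -/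
noncomputable def parU (n : ℕ) : U n →ₐ[K] U n :=
  U.lift (fun i j => sgn (par i + par j) • L i j)
    (fun i j h => by rw [L_of_not_le h, smul_zero])
    (fun i => by simp [CharTwo.add_self_eq_zero, L_inv])
    (fun a j c l => by
      have h := congrArg (fun x => sgn (par a + par j + (par c + par l)) • x) (L_rll a j c l)
      simp only [relLeft, relRight, Finset.smul_sum] at h ⊢
      convert h using 1
      · refine Finset.sum_congr rfl fun b _ => Finset.sum_congr rfl fun d _ => ?_
        by_cases h0 : par b + par j + (par d + par l) = 0
        · rw [smul_mul_smul_comm, smul_comm, ← sgn_add]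
          congr 2
          generalize par a = a, par j = j, par c = c, par l = l, par b = b, par d = d at h0
          revert a j c l b d; decide
        · simp [Smat_even _ _ _ _ h0]
      · refine Finset.sum_congr rfl fun b _ => Finset.sum_congr rfl fun d _ => ?_
        by_cases h0 : par a + par b + (par c + par d) = 0
        · rw [smul_mul_smul_comm, smul_comm, ← sgn_add]
          congr 2
          generalize par a = a, par j = j, par c = c, par l = l, par b = b, par d = d at h0
          revert a j c l b d; decide
        · simp [Smat_even _ _ _ _ h0])

@[simp] theorem parU_L {n : ℕ} (i j : Idx n) : parU n (L i j) = sgn (par i + par j) • L i j :=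
  U.lift_L _ _ _ _ i j

theorem parU_parU {n : ℕ} (x : U n) : parU n (parU n x) = x := by
  have : (parU n).comp (parU n) = AlgHom.id K (U n) := by
    apply U.hom_ext
    intro i j
    simp [smul_smul]
  exact DFunLike.congr_fun this x

/-- The parity automorphism as a linear map. -/
noncomputable def parUL (n : ℕ) : U n →ₗ[K] U n := (parU n).toLinearMap

theorem parUL_apply {n : ℕ} (x : U n) : parUL n x = parU n x := rfl

theorem parUL_parUL {n : ℕ} (x : U n) : parUL n (parUL n x) = x := parU_parU x

/-- The even and the odd part of `U_q(q_n)`; the generator `L_{ij}` has parity `|i| + |j|`. -/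
noncomputable def gradU (n : ℕ) : ZMod 2 → Submodule K (U n) := parityPart (parUL n)

theorem mem_gradU {n : ℕ} {p : ZMod 2} {x : U n} : x ∈ gradU n p ↔ parU n x = sgn p • x :=
  mem_parityPart

theorem L_mem {n : ℕ} (i j : Idx n) : L i j ∈ gradU n (par i + par j) :=
  mem_gradU.2 (parU_L i j)

/-- The decomposition of an element into its even and its odd part. -/
noncomputable def decompU (n : ℕ) : U n →ₗ[K] DirectSum (ZMod 2) fun p => gradU n p :=
  ∑ p, DirectSum.lof K (ZMod 2) (fun p => gradU n p) p ∘ₗ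
    (parityProj (parUL n) p).codRestrict (gradU n p)
      (parityProj_mem (parUL n) parUL_parUL p)

noncomputable instance (n : ℕ) : GradedAlgebra (gradU n) where
  one_mem := mem_gradU.2 (by simp)
  mul_mem p r x y hx hy := by
    rw [mem_gradU] at *
    rw [map_mul, hx, hy, smul_mul_smul_comm, sgn_add]
  decompose' x := decompU n x
  left_inv x := by
    simp only [decompU, sum_zmod2, map_add, LinearMap.add_apply, LinearMap.comp_apply,
      DirectSum.lof_eq_of, DirectSum.coeAddMonoidHom_of]
    exact parityProj_add _ x
  right_inv x := by
    induction x using DirectSum.induction_on with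
    | zero => simp
    | of p x =>
      have h : ∀ r, (parityProj (parUL n) r).codRestrict (gradU n r)
          (parityProj_mem (parUL n) parUL_parUL r) x.1
          = if h : p = r then (h ▸ x) else 0 := by
        intro r
        apply Subtype.ext
        refine (LinearMap.codRestrict_apply _ _ _).trans ?_
        rw [parityProj_of_mem _ x.2]
        by_cases h : p = r
        · subst h; simp
        · simp [h, Ne.symm h]
      simp only [decompU, LinearMap.sum_apply, LinearMap.comp_apply, DirectSum.lof_eq_of,
        DirectSum.coeAddMonoidHom_of, h]
      rw [Finset.sum_eq_single p]
      · simp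
      · intro r _ hr; simp [Ne.symm hr]
      · simp
    | add x y hx hy =>
      simp only at hx hy ⊢
      rw [map_add]; exact (map_add (decompU n) _ _).trans (by rw [hx, hy])

/-! ### The coproduct and the counit -/

section Coproduct

theorem uzpow_smul_eq {M : Type*} [AddCommGroup M] [Module K M] (p : ZMod 2) (x : M) :
    ((-1 : ℤˣ) ^ p) • x = sgn p • x := by
  rcases zmod2_cases p with rfl | rfl
  · simp
  · rw [uzpow_one, sgn_one, Units.neg_smul, one_smul, neg_smul, one_smul]

/-- The superalgebra `U_q(q_n) ⊗ U_q(q_n)`, with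
`(x ⊗ y) (x' ⊗ y') = (-1)^{|y||x'|} x x' ⊗ y y'`. -/
abbrev UU (n : ℕ) : Type := GradedTensorProduct K (gradU n) (gradU n)

/-- The tensor `x ⊗ y` in `U_q(q_n) ⊗ U_q(q_n)`. -/
noncomputable def tm {n : ℕ} (x y : U n) : UU n := GradedTensorProduct.tmul K x y

theorem tm_mul_tm {n : ℕ} {p r : ZMod 2} (a : U n) {b a' : U n} (b' : U n)
    (hb : b ∈ gradU n p) (ha : a' ∈ gradU n r) :
    (tm a b * tm a' b' : UU n) = sgn (p * r) • tm (a * a') (b * b') := by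
  have := GradedTensorProduct.tmul_coe_mul_coe_tmul (R := K) (gradU n) (gradU n)
    a ⟨b, hb⟩ ⟨a', ha⟩ b'
  rw [uzpow_smul_eq] at this
  exact this

theorem tm_sum_left {n : ℕ} {ι : Type*} (s : Finset ι) (f : ι → U n) (y : U n) :
    (tm (∑ i ∈ s, f i) y : UU n) = ∑ i ∈ s, tm (f i) y := by
  simp only [tm, GradedTensorProduct.tmul, TensorProduct.sum_tmul, map_sum]

theorem tm_sum_right {n : ℕ} {ι : Type*} (s : Finset ι) (f : ι → U n) (x : U n) :
    (tm x (∑ i ∈ s, f i) : UU n) = ∑ i ∈ s, tm x (f i) := by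
  simp only [tm, GradedTensorProduct.tmul, TensorProduct.tmul_sum, map_sum]

theorem tm_smul_left {n : ℕ} (c : K) (x y : U n) : (tm (c • x) y : UU n) = c • tm x y := by
  simp only [tm, GradedTensorProduct.tmul, ← TensorProduct.smul_tmul', map_smul]

theorem tm_smul_right {n : ℕ} (c : K) (x y : U n) : (tm x (c • y) : UU n) = c • tm x y := by
  simp only [tm, GradedTensorProduct.tmul, TensorProduct.tmul_smul, map_smul]

/-- `∑_k (-1)^{(|i|+|k|)(|k|+|j|)} L_{ik} ⊗ L_{kj}`; only `i ≤ k ≤ j` contribute. -/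
noncomputable def coprL {n : ℕ} (i j : Idx n) : UU n :=
  ∑ k, sgn ((par i + par k) * (par k + par j)) • tm (L i k) (L k j)

theorem coprL_mul {n : ℕ} (a b c d : Idx n) :
    coprL a b * coprL c d = ∑ e, ∑ f, (sgn ((par a + par e) * (par e + par b)) *
      sgn ((par c + par f) * (par f + par d)) * sgn ((par e + par b) * (par c + par f))) •
        tm (L a e * L c f) (L e b * L f d) := by
  simp only [coprL, Finset.sum_mul_sum, smul_mul_smul_comm]
  refine Finset.sum_congr rfl fun e _ => Finset.sum_congr rfl fun f _ => ?_
  rw [tm_mul_tm _ _ (L_mem e b) (L_mem c f), smul_smul]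

/-- An auxiliary sign exponent. -/
def sgL (a e c f j l : ZMod 2) : ZMod 2 :=
  f + e + f * l + e * l + e * j + c * f + e * c + c * l + a * e + a * l + a * j + a * c

/-- An auxiliary sign exponent. -/
def sgR (a e c f j l : ZMod 2) : ZMod 2 :=
  e + e * l + e * j + f + f * l + e * f + c * l + c * f + a * l + a * j + a * e + a * f

theorem coprL_sign_left (a b c d e f j l : ZMod 2) (h : b + j + (d + l) = 0) :
    sgn ((a + b) * (c + d)) * sgn ((c + d) * (b + j)) * (sgn ((a + e) * (e + b)) *
      sgn ((c + f) * (f + d)) * sgn ((e + b) * (c + f))) =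
    sgn (sgL a e c f j l) * (sgn ((e + b) * (f + d)) * sgn ((f + d) * (b + j))) := by
  simp only [← sgn_add]
  congr 1
  revert a b c d e f j l; unfold sgL; decide

theorem coprL_sign_right (a b c d e f j l : ZMod 2) (h : a + b + (c + d) = 0) :
    sgn ((c + d) * (b + j)) * (sgn ((d + f) * (f + l)) * sgn ((b + e) * (e + j)) *
      sgn ((f + l) * (b + e))) =
    sgn (sgR a e c f j l) * sgn ((c + d) * (b + e)) := by
  simp only [← sgn_add]
  congr 1
  revert a b c d e f j l; unfold sgR; decide

theorem coprL_sign_mid (a b c d e f j l : ZMod 2) (h : e + b + (f + d) = 0) :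
    sgn (sgL a e c f j l) * sgn ((f + d) * (b + j)) =
    sgn (sgR a b c d j l) * (sgn ((a + e) * (c + f)) * sgn ((c + f) * (e + b))) := by
  simp only [← sgn_add]
  congr 1
  revert a b c d e f j l; unfold sgL sgR; decide

theorem sum4_comm {ι G : Type*} [Fintype ι] [AddCommMonoid G] (F : ι → ι → ι → ι → G) :
    ∑ b, ∑ d, ∑ e, ∑ f, F b d e f = ∑ e, ∑ f, ∑ b, ∑ d, F b d e f := by
  calc _ = ∑ b, ∑ e, ∑ f, ∑ d, F b d e f := by
        refine Finset.sum_congr rfl fun b _ => ?_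
        rw [Finset.sum_comm]
        exact Finset.sum_congr rfl fun e _ => Finset.sum_comm
    _ = _ := by
        rw [Finset.sum_comm]
        exact Finset.sum_congr rfl fun e _ => Finset.sum_comm

theorem coprL_rll {n : ℕ} (a j c l : Idx n) :
    relLeft coprL a j c l = relRight coprL a j c l := by
  have e1 : relLeft coprL a j c l = ∑ e, ∑ f, sgn (sgL (par a) (par e) (par c) (par f) (par j) (par l)) •
        tm (L a e * L c f) (relLeft L e j f l) := by
    simp only [relLeft, coprL_mul, Finset.smul_sum, tm_sum_right, tm_smul_right, smul_smul]
    rw [sum4_comm]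
    refine Finset.sum_congr rfl fun e _ => Finset.sum_congr rfl fun f _ =>
      Finset.sum_congr rfl fun b _ => Finset.sum_congr rfl fun d _ => ?_
    by_cases h0 : par b + par j + (par d + par l) = 0
    · refine congrArg₂ (· • ·) ?_ rfl
      have := coprL_sign_left (par a) _ (par c) _ (par e) (par f) _ _ h0
      linear_combination Smat b j d l * this
    · simp [Smat_even _ _ _ _ h0]
  have e2 : relRight coprL a j c l = ∑ e, ∑ f, sgn (sgR (par a) (par e) (par c) (par f) (par j) (par l)) •
        tm (relRight L a e c f) (L f l * L e j) := by
    simp only [relRight, coprL_mul, Finset.smul_sum, tm_sum_left, tm_smul_left, smul_smul]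
    rw [sum4_comm, Finset.sum_comm]
    refine Finset.sum_congr rfl fun e _ => Finset.sum_congr rfl fun f _ =>
      Finset.sum_congr rfl fun b _ => Finset.sum_congr rfl fun d _ => ?_
    by_cases h0 : par a + par b + (par c + par d) = 0
    · refine congrArg₂ (· • ·) ?_ rfl
      have := coprL_sign_right _ _ _ _ (par e) (par f) (par j) (par l) h0
      linear_combination Smat a b c d * this
    · simp [Smat_even _ _ _ _ h0]
  rw [e1, e2]
  simp only [L_rll _ j _ l, ← L_rll a _ c _]
  simp only [relLeft, relRight, Finset.smul_sum, tm_sum_left, tm_smul_left, tm_sum_right,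
    tm_smul_right, smul_smul]
  rw [sum4_comm]
  refine Finset.sum_congr rfl fun b _ => Finset.sum_congr rfl fun d _ =>
    Finset.sum_congr rfl fun e _ => Finset.sum_congr rfl fun f _ => ?_
  by_cases h0 : par e + par b + (par f + par d) = 0
  · refine congrArg₂ (· • ·) ?_ rfl
    have := coprL_sign_mid (par a) _ (par c) _ _ _ (par j) (par l) h0
    linear_combination Smat e b f d * this
  · simp [Smat_even _ _ _ _ h0]

theorem coprL_of_not_le {n : ℕ} (i j : Idx n) (h : ¬ i ≤ j) : coprL i j = 0 := by
  refine Finset.sum_eq_zero fun k _ => ?_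
  by_cases h1 : i ≤ k
  · rw [L_of_not_le (i := k) (j := j) fun h2 => h (h1.trans h2)]
    simp [tm, GradedTensorProduct.tmul]
  · rw [L_of_not_le h1]
    simp [tm, GradedTensorProduct.tmul]

theorem coprL_diag {n : ℕ} (i : Idx n) : coprL i i = tm (L i i) (L i i) := by
  rw [coprL, Finset.sum_eq_single i]
  · simp [CharTwo.add_self_eq_zero]
  · intro k _ hk
    rcases lt_or_gt_of_ne hk with h | h
    · rw [L_of_not_le (i := i) (j := k) (not_le.2 h)]
      simp [tm, GradedTensorProduct.tmul]
    · rw [L_of_not_le (i := k) (j := i) (not_le.2 h)]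
      simp [tm, GradedTensorProduct.tmul]
  · simp

theorem coprL_inv {n : ℕ} (i : Idx n) : coprL i i * coprL (-i) (-i) = 1 := by
  have h0 : ∀ k : Idx n, L k k ∈ gradU n 0 := fun k => by
    have := L_mem k k
    rwa [CharTwo.add_self_eq_zero] at this
  rw [coprL_diag, coprL_diag, tm_mul_tm _ _ (h0 i) (h0 (-i)), L_inv]
  simp only [mul_zero, sgn_zero, one_smul]
  rfl

/-- The comultiplication of `U_q(q_n)`:
`Δ(L_{ij}) = ∑_{i≤k≤j} (-1)^{(|i|+|k|)(|k|+|j|)} L_{ik} ⊗ L_{kj}`. -/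
noncomputable def comulU (n : ℕ) : U n →ₐ[K] UU n :=
  U.lift coprL coprL_of_not_le coprL_inv coprL_rll

theorem comulU_L {n : ℕ} (i j : Idx n) : comulU n (L i j) = coprL i j := U.lift_L _ _ _ _ i j

/-- The counit of `U_q(q_n)`: `ε(L_{ij}) = δ_{ij}`. -/
noncomputable def counitU (n : ℕ) : U n →ₐ[K] K :=
  U.lift (fun i j => if i = j then 1 else 0)
    (fun i j h => if_neg fun e => h e.le)
    (fun i => by simp)
    (fun a j c l => by
      simp only [relLeft, relRight]
      rw [Finset.sum_eq_single a, Finset.sum_eq_single c, Finset.sum_eq_single j,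
        Finset.sum_eq_single l]
      · simp [CharTwo.add_self_eq_zero]
      · intro d _ hd; simp [hd]
      · simp
      · intro d _ hd; simp [hd]
      · simp
      · intro d _ hd; simp [Ne.symm hd]
      · simp
      · intro d _ hd; simp [Ne.symm hd]
      · simp)

theorem counitU_L {n : ℕ} (i j : Idx n) : counitU n (L i j) = if i = j then 1 else 0 :=
  U.lift_L _ _ _ _ i j

end Coproduct

/-! ### The vector supermodule -/

section VectorRep

/-- Sign of an integer, as a scalar. -/
def sI {F : Type*} [Field F] (i : ℤ) : F := if 0 < i then 1 else -1

/-- Kronecker delta on integers. -/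
def dI {F : Type*} [Field F] (i j : ℤ) : F := if i = j then 1 else 0

/-- Auxiliary: the scalar `C_{ij}` with `L_{ij} ↦ δ_{ij} + C_{ij} (E_{ji} + E_{-j,-i})`. -/
def cI {F : Type*} [Field F] (q qi : F) (i j : ℤ) : F :=
  if i < j then (q - qi) * sI i else if i = j then (if 0 < i then q - 1 else qi - 1) else 0

/-- Auxiliary: matrix coefficients of the product of the images of `L_{aj}` and `L_{cl}`. -/
def mI {F : Type*} [Field F] (q qi : F) (f : ℤ → ℤ → F) (a j c l : ℤ) : F :=
  dI a j * dI c l + dI a j * cI q qi c l * f c l + dI c l * cI q qi a j * f a j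
   + cI q qi a j * cI q qi c l * (dI a l * f c j + dI a (-l) * f c (-j))

/-- Auxiliary: the value of `q^{φ(a,c)}`. -/
def phI {F : Type*} [Field F] (q qi : F) (a c : ℤ) : F :=
  if a = c ∨ a = -c then (if 0 < c then q else qi) else 1

/-- Auxiliary: the Koszul sign of two pairs of indices. -/
def spI {F : Type*} [Field F] (a b c d : ℤ) : F :=
  if (decide (0 < a) ≠ decide (0 < b)) ∧ (decide (0 < c) ≠ decide (0 < d)) then -1 else 1

set_option maxHeartbeats 4000000 in
theorem yangBaxter_aux {F : Type*} [Field F] (q qi : F) (hq : q * qi = 1)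
    (f : ℤ → ℤ → F) (hf : ∀ i j, f (-i) (-j) = f i j)
    (a j c l : ℤ) (ha : a ≠ 0) (hj : j ≠ 0) (hc : c ≠ 0) (hl : l ≠ 0) :
    spI a j c l * phI q qi j l * mI q qi f a j c l
     + (if j < l then (q - qi) * sI j * (spI a l c j * spI c j l j) * mI q qi f a l c j else 0)
     + (if -j < l then (q - qi) * sI (-j) * (spI a (-l) c (-j) * spI c (-j) (-l) j) *
          mI q qi f a (-l) c (-j) else 0)
    = phI q qi a c * mI q qi f c l a j
     + (if c < a then (q - qi) * sI c * (spI c a c j) * mI q qi f a l c j else 0)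
     + (if c < -a then (q - qi) * sI c * (spI c (-a) (-c) j) * mI q qi f (-a) l (-c) j
          else 0) := by
  have hm : ∀ i j : ℤ, f (-i) j = f i (-j) := fun i j => by rw [← hf, neg_neg]
  have dp : ∀ i j : ℤ, i = j → (dI i j : F) = 1 := fun i j h => if_pos h
  have dn : ∀ i j : ℤ, i ≠ j → (dI i j : F) = 0 := fun i j h => if_neg h
  by_cases e1 : a = j <;> by_cases e2 : a = -j <;> try omega
  all_goals by_cases e3 : c = l <;> by_cases e4 : c = -l <;> try omega
  all_goals by_cases e5 : a = l <;> by_cases e6 : a = -l <;> try omega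
  all_goals by_cases e7 : c = j <;> by_cases e8 : c = -j <;> try omega
  all_goals simp (disch := omega) only [mI, dp, dn, hf, hm, neg_neg, mul_zero, zero_mul, mul_one,
    one_mul, add_zero, zero_add, ite_self]
  all_goals subst_vars
  all_goals simp only [neg_neg, cI, sI, phI, spI]
  all_goals first
    | grind (splits := 30)
    | skip
  all_goals (
    try simp only [hf]
    rcases lt_or_gt_of_ne hj with h1 | h1 <;> rcases lt_or_gt_of_ne hl with h2 | h2 <;>
      rcases lt_trichotomy j l with h3 | h3 | h3 <;> try omega
    all_goals rcases lt_trichotomy (-j) l with h4 | h4 | h4 <;> try omega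
    all_goals simp (disch := omega) only [if_pos, if_neg, decide_eq_true, decide_eq_false,
      ne_eq, not_true_eq_false, and_false, not_false_eq_true, and_true, true_or, if_true, if_false,
      Bool.false_eq_true, Bool.true_eq_false]
    all_goals try grind)

theorem sum_pair {n : ℕ} (x y : Idx n) (G : Idx n → Idx n → K) :
    ∑ b, ∑ d, (if b = x ∧ d = y then G b d else 0) = G x y := by
  rw [Finset.sum_eq_single x, Finset.sum_eq_single y]
  · simp
  · intro d _ hd; simp [hd]
  · simp
  · intro b _ hb; simp [hb]
  · simp

theorem idx_eq_neg {n : ℕ} (i j : Idx n) : i = -j ↔ j = -i := by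
  rw [Subtype.ext_iff, Subtype.ext_iff, neg_val, neg_val]; omega

theorem sum_Smat_left {n : ℕ} (j l : Idx n) (g : Idx n → Idx n → K) :
    ∑ b, ∑ d, Smat b j d l * g b d = q ^ phi j l * g j l +
      (if j < l then xi * sgn (par j) * g l j else 0) +
      (if -j < l then xi * sgn (par (-j)) * g (-l) (-j) else 0) := by
  have h : ∀ b d : Idx n, Smat b j d l * g b d =
      (if b = j ∧ d = l then q ^ phi b d * g b d else 0) +
      (if b = l ∧ d = j then (if d < l then xi * sgn (par d) * g b d else 0) else 0) +
      (if b = -l ∧ d = -j then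
        (if d < l then xi * sgn (par d) * g b d else 0) else 0) := by
    intro b d
    unfold Smat
    simp only [idx_eq_neg j d, eq_comm (a := j) (b := d)]
    split_ifs <;> ring
  simp only [h, Finset.sum_add_distrib, sum_pair]

theorem sum_Smat_right {n : ℕ} (a c : Idx n) (g : Idx n → Idx n → K) :
    ∑ b, ∑ d, Smat a b c d * g b d = q ^ phi a c * g a c +
      (if c < a then xi * sgn (par c) * g c a else 0) +
      (if c < -a then xi * sgn (par c) * g (-c) (-a) else 0) := by
  have h : ∀ b d : Idx n, Smat a b c d * g b d =
      (if b = a ∧ d = c then q ^ phi a c * g b d else 0) +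
      (if b = c ∧ d = a then (if c < d then xi * sgn (par c) * g b d else 0) else 0) +
      (if b = -c ∧ d = -a then
        (if c < d then xi * sgn (par c) * g b d else 0) else 0) := by
    intro b d
    unfold Smat
    simp only [idx_eq_neg a d, eq_comm (a := a), eq_comm (a := c) (b := d),
      and_comm (a := d = a), and_comm (a := d = -a)]
    split_ifs <;> ring
  simp only [h, Finset.sum_add_distrib, sum_pair]

theorem phI_eq {n : ℕ} (a c : Idx n) : phI q q⁻¹ a.1 c.1 = q ^ phi a c := by
  have h1 := idx_ne_zero a
  have h2 := idx_ne_zero c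
  have e : ∀ i j : Idx n, i = j ↔ i.1 = j.1 := fun i j => Subtype.ext_iff
  simp only [phI, phi, par, e, neg_val]
  by_cases e1 : a.1 = c.1
  · have e2 : ¬ a.1 = -c.1 := by omega
    rw [if_pos (Or.inl e1), if_pos e1, if_neg e2]
    by_cases e3 : 0 < c.1 <;> simp [e3, ZMod.val_one]
  · by_cases e2 : a.1 = -c.1
    · rw [if_pos (Or.inr e2), if_neg e1, if_pos e2]
      by_cases e3 : 0 < c.1 <;> simp [e3, ZMod.val_one]
    · rw [if_neg (by tauto), if_neg e1, if_neg e2]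
      simp

theorem sI_eq {n : ℕ} (a : Idx n) : sI a.1 = sgn (par a) := by
  unfold sI par; split_ifs <;> simp

theorem spI_eq {n : ℕ} (a b c d : Idx n) :
    spI a.1 b.1 c.1 d.1 = sgn ((par a + par b) * (par c + par d)) := by
  unfold spI par
  by_cases h1 : 0 < a.1 <;> by_cases h2 : 0 < b.1 <;> by_cases h3 : 0 < c.1 <;>
    by_cases h4 : 0 < d.1 <;> simp [h1, h2, h3, h4, show (1 + 1 : ZMod 2) = 0 from rfl]

/-- The matrix of the action of `L_{ij}` on the vector supermodule: the second tensor factor of `S`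
is turned into `L`. -/
noncomputable def matL {n : ℕ} (i j : Idx n) : Matrix (Idx n) (Idx n) K :=
  Matrix.of fun a b => Smat a b i j

/-- Matrix coefficient of `E_{ji} + E_{-j,-i}`. -/
noncomputable def fI {n : ℕ} (x y : Idx n) (i j : ℤ) : K :=
  (if x.1 = j ∧ y.1 = i then 1 else 0) + (if x.1 = -j ∧ y.1 = -i then 1 else 0)

theorem fI_neg {n : ℕ} (x y : Idx n) (i j : ℤ) : fI x y (-i) (-j) = fI x y i j := by
  simp only [fI, neg_neg]; ring

theorem Smat_eq_fI {n : ℕ} (x y i j : Idx n) :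
    Smat x y i j = (if x = y then dI i.1 j.1 else 0) + cI q q⁻¹ i.1 j.1 * fI x y i.1 j.1 := by
  have hx := idx_ne_zero x
  have hi := idx_ne_zero i
  unfold Smat
  rw [← phI_eq, ← sI_eq]
  simp only [phI, cI, dI, fI, xi, ← Subtype.coe_lt_coe, Subtype.ext_iff, neg_val]
  rcases lt_trichotomy i.1 j.1 with h | h | h
  · have h' : i.1 ≠ j.1 := h.ne
    simp [h, h']
  · simp only [h, lt_irrefl, if_false, if_true, and_true, add_zero]
    by_cases e : x.1 = y.1
    · simp only [e]
      by_cases e1 : y.1 = j.1 <;> by_cases e2 : y.1 = -j.1 <;> simp [e1, e2] <;> grind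
    · have e1 : ¬(x.1 = j.1 ∧ y.1 = j.1) := fun h => e (h.1.trans h.2.symm)
      have e2 : ¬(x.1 = -j.1 ∧ y.1 = -j.1) := fun h => e (h.1.trans h.2.symm)
      simp only [e, e1, e2, if_false, add_zero, mul_zero]
  · have h1 : i.1 ≠ j.1 := h.ne'
    have h2 : ¬ i.1 < j.1 := by omega
    simp [h1, h2]

theorem sum_fI {n : ℕ} (x y a j c l : Idx n) :
    ∑ z, fI x z a.1 j.1 * fI z y c.1 l.1 =
      dI a.1 l.1 * fI x y c.1 j.1 + dI a.1 (-l.1) * fI x y c.1 (-j.1) := by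
  have h : ∀ z : Idx n, fI x z a.1 j.1 * fI z y c.1 l.1 =
      (if z = a then (if x.1 = j.1 then fI a y c.1 l.1 else 0) else 0) +
      (if z = -a then (if x.1 = -j.1 then fI (-a) y c.1 l.1 else 0) else 0) := by
    intro z
    have e1 : z.1 = a.1 ↔ z = a := Subtype.ext_iff.symm
    have e2 : z.1 = -a.1 ↔ z = -a := by rw [Subtype.ext_iff, neg_val]
    simp only [fI, e1, e2]
    rw [add_mul]
    by_cases h1 : z = a
    · rw [← h1]
      have : z ≠ -z := fun h => by
        have := congrArg Subtype.val h
        have := idx_ne_zero z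
        simp only [neg_val] at *
        omega
      simp [this]
    · by_cases h2 : z = -a
      · rw [← h2]; simp [h1]
      · simp [h1, h2]
  simp only [h, Finset.sum_add_distrib, Finset.sum_ite_eq', Finset.mem_univ, if_true]
  have ha := idx_ne_zero a
  have hl := idx_ne_zero l
  have hj := idx_ne_zero j
  simp only [fI, dI, neg_val, neg_neg]
  by_cases e1 : a.1 = l.1 <;> by_cases e2 : a.1 = -l.1 <;> by_cases e3 : x.1 = j.1 <;>
    by_cases e4 : x.1 = -j.1 <;> try omega
  all_goals simp [e1, e2, e3, e4]
  all_goals grind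

theorem matL_mul {n : ℕ} (a j c l x y : Idx n) :
    (matL a j * matL c l) x y = mI q q⁻¹ (fI x y) a.1 j.1 c.1 l.1 +
      ((if x = y then 1 else 0) - 1) * mI q q⁻¹ (fun _ _ => 0) a.1 j.1 c.1 l.1 := by
  rw [Matrix.mul_apply]
  simp only [matL, Matrix.of_apply, Smat_eq_fI]
  have := sum_fI x y a j c l
  simp only [add_mul, mul_add, Finset.sum_add_distrib]
  have e1 : ∑ z, cI q q⁻¹ a.1 j.1 * fI x z a.1 j.1 * (cI q q⁻¹ c.1 l.1 * fI z y c.1 l.1) =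
      cI q q⁻¹ a.1 j.1 * cI q q⁻¹ c.1 l.1 * (dI a.1 l.1 * fI x y c.1 j.1 +
        dI a.1 (-l.1) * fI x y c.1 (-j.1)) := by
    rw [← this, Finset.mul_sum]
    exact Finset.sum_congr rfl fun z _ => by ring
  rw [e1]
  simp only [ite_mul, mul_ite, zero_mul, mul_zero, Finset.sum_ite_eq, Finset.sum_ite_eq',
    Finset.mem_univ, if_true, mI]
  split_ifs <;> ring

theorem matL_relLeft {n : ℕ} (a j c l x y : Idx n) :
    relLeft matL a j c l x y = ∑ b, ∑ d, Smat b j d l *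
      ((sgn ((par a + par b) * (par c + par d)) * sgn ((par c + par d) * (par b + par j))) *
        (matL a b * matL c d) x y) := by
  simp only [relLeft, Matrix.sum_apply, Matrix.smul_apply, smul_eq_mul]
  exact Finset.sum_congr rfl fun b _ => Finset.sum_congr rfl fun d _ => by ring

theorem matL_relRight {n : ℕ} (a j c l x y : Idx n) :
    relRight matL a j c l x y = ∑ b, ∑ d, Smat a b c d *
      (sgn ((par c + par d) * (par b + par j)) * (matL d l * matL b j) x y) := by
  simp only [relRight, Matrix.sum_apply, Matrix.smul_apply, smul_eq_mul]
  exact Finset.sum_congr rfl fun b _ => Finset.sum_congr rfl fun d _ => by ring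

theorem matL_rll {n : ℕ} (a j c l : Idx n) : relLeft matL a j c l = relRight matL a j c l := by
  ext x y
  rw [matL_relLeft, matL_relRight, sum_Smat_left, sum_Smat_right]
  have key := fun (f : ℤ → ℤ → K) hf => yangBaxter_aux q q⁻¹ (mul_inv_cancel₀ q_ne_zero) f hf
    a.1 j.1 c.1 l.1 (idx_ne_zero a) (idx_ne_zero j) (idx_ne_zero c) (idx_ne_zero l)
  have k1 := key (fI x y) (fI_neg x y)
  have k2 := key (fun _ _ => 0) (fun _ _ => rfl)
  clear key
  simp only [matL_mul, ← spI_eq, ← phI_eq, ← sI_eq, ← Subtype.coe_lt_coe, neg_val]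
  have s1 : (spI a.1 j.1 c.1 l.1 * spI c.1 l.1 j.1 j.1 : K) = spI a.1 j.1 c.1 l.1 := by
    rw [spI_eq c l j j]; simp [CharTwo.add_self_eq_zero]
  have s2 : (spI c.1 c.1 a.1 j.1 : K) = 1 := by
    rw [spI_eq c c a j]; simp [CharTwo.add_self_eq_zero]
  rw [s1, s2]
  unfold xi
  generalize ((if x = y then (1 : K) else 0) - 1) = δ
  by_cases c1 : j.1 < l.1 <;> by_cases c2 : -j.1 < l.1 <;> by_cases c3 : c.1 < a.1 <;>
    by_cases c4 : c.1 < -a.1 <;>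
    simp only [c1, c2, c3, c4, if_true, if_false] at k1 k2 ⊢ <;>
    linear_combination k1 + δ * k2

/-- The vector supermodule of `U_q(q_n)`: the generators `L_{ij}` act by the entries of `S`, that is,
`L` acts on it by `S`. -/
noncomputable def vecRep (n : ℕ) : U n →ₐ[K] Matrix (Idx n) (Idx n) K :=
  U.lift matL
    (fun i j h => by
      ext a b
      have h1 : ¬ i < j := fun h' => h h'.le
      have h2 : i ≠ j := fun h' => h h'.le
      simp [matL, Smat, h1, h2])
    (fun i => by
      ext x y
      rw [matL_mul]
      rw [show (1 : Matrix (Idx n) (Idx n) K) x y = if x = y then 1 else 0 from Matrix.one_apply]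
      have hi := idx_ne_zero i
      have n1 : i.1 ≠ -i.1 := by omega
      have n2 : -i.1 ≠ i.1 := by omega
      have f1 := fI_neg x y i.1 i.1
      have hq := mul_inv_cancel₀ q_ne_zero
      rcases lt_or_gt_of_ne hi with h | h
      · have h' : ¬ 0 < i.1 := by omega
        simp [mI, dI, cI, n1, h, h', f1]
        linear_combination fI x y i.1 i.1 * hq
      · have h' : ¬ i.1 < 0 := by omega
        simp [mI, dI, cI, n1, h, h', f1]
        linear_combination fI x y i.1 i.1 * hq)
    matL_rll

theorem vecRep_L {n : ℕ} (i j a b : Idx n) : vecRep n (L i j) a b = Smat a b i j := by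
  rw [vecRep, U.lift_L]; rfl

end VectorRep

/-! ### The finite dual -/

section FiniteDual

theorem hom_ext_parity {M N P : Type*} [AddCommGroup M] [Module K M] [AddCommGroup N] [Module K N]
    [AddCommGroup P] [Module K P] {γ : M →ₗ[K] M} {γ' : N →ₗ[K] N} (h : ∀ x, γ (γ x) = x)
    (h' : ∀ x, γ' (γ' x) = x) {f g : M ⊗[K] N →ₗ[K] P}
    (H : ∀ p r, ∀ x ∈ parityPart γ p, ∀ y ∈ parityPart γ' r, f (x ⊗ₜ y) = g (x ⊗ₜ y)) : f = g := by
  apply TensorProduct.ext'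
  intro x y
  rw [← parityProj_add γ x, ← parityProj_add γ' y]
  simp only [TensorProduct.add_tmul, TensorProduct.tmul_add, map_add]
  rw [H _ _ _ (parityProj_mem γ h 0 x) _ (parityProj_mem γ' h' 0 y),
    H _ _ _ (parityProj_mem γ h 0 x) _ (parityProj_mem γ' h' 1 y),
    H _ _ _ (parityProj_mem γ h 1 x) _ (parityProj_mem γ' h' 0 y),
    H _ _ _ (parityProj_mem γ h 1 x) _ (parityProj_mem γ' h' 1 y)]

theorem koszul_koszul {M N : Type*} [AddCommGroup M] [Module K M] [AddCommGroup N] [Module K N]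
    {γ : M →ₗ[K] M} {γ' : N →ₗ[K] N} (h : ∀ x, γ (γ x) = x)
    (h' : ∀ x, γ' (γ' x) = x) (z : M ⊗[K] N) : koszul γ γ' (koszul γ γ' z) = z := by
  have : koszul γ γ' ∘ₗ koszul γ γ' = LinearMap.id := by
    apply hom_ext_parity h h'
    intro p r x hx y hy
    rw [LinearMap.comp_apply, koszul_tmul γ γ' hx hy, map_smul, koszul_tmul γ γ' hx hy, smul_smul,
      sgn_mul_self, one_smul, LinearMap.id_apply]
  exact LinearMap.congr_fun this z

theorem dualDistrib_injective (M N : Type*) [AddCommGroup M] [Module K M] [AddCommGroup N]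
    [Module K N] : Function.Injective (TensorProduct.dualDistrib K M N) := by
  classical
  rw [injective_iff_map_eq_zero]
  intro z hz
  let b := Module.Basis.ofVectorSpace K (Module.Dual K N)
  obtain ⟨w, rfl⟩ := (TensorProduct.equivFinsuppOfBasisRight (M := Module.Dual K M) b).symm.surjective z
  rw [TensorProduct.equivFinsuppOfBasisRight_symm_apply] at hz
  have hw : w = 0 := by
    ext i x
    have h1 : ∑ i ∈ w.support, (w i x) • b i = 0 := by
      ext y
      have := LinearMap.congr_fun hz (x ⊗ₜ y)
      simpa [Finsupp.sum, LinearMap.sum_apply] using this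
    by_cases hi : i ∈ w.support
    · exact linearIndependent_iff'.1 b.linearIndependent _ _ h1 i hi
    · rw [Finsupp.notMem_support_iff.1 hi]; rfl
  rw [hw, map_zero]

theorem decompose_coe {n : ℕ} (x : U n) (p : ZMod 2) :
    ((DirectSum.decompose (gradU n) x) p : U n) = parityProj (parUL n) p x := by
  have hx := parityProj_add (parUL n) x
  have h : ∀ r, ((DirectSum.decompose (gradU n) (parityProj (parUL n) r x)) p : U n) =
      if r = p then parityProj (parUL n) r x else 0 := by
    intro r
    have hm : parityProj (parUL n) r x ∈ gradU n r := parityProj_mem _ parUL_parUL r x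
    split_ifs with h
    · subst h; exact DirectSum.decompose_of_mem_same _ hm
    · exact DirectSum.decompose_of_mem_ne _ hm h
  conv_lhs => rw [← hx, DirectSum.decompose_add]
  rw [DirectSum.add_apply, Submodule.coe_add, h, h]
  rcases zmod2_cases p with rfl | rfl <;> simp

theorem isHomogeneous_iff {n : ℕ} (I : Ideal (U n)) :
    I.IsHomogeneous (gradU n) ↔ ∀ x ∈ I, parU n x ∈ I := by
  constructor
  · intro h x hx
    have h0 := h 0 hx
    have h1 := h 1 hx
    rw [decompose_coe] at h0 h1
    have : parU n x = parityProj (parUL n) 0 x - parityProj (parUL n) 1 x := by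
      conv_lhs => rw [← parityProj_add (parUL n) x, map_add]
      rw [mem_gradU.1 (parityProj_mem (parUL n) parUL_parUL 0 x),
        mem_gradU.1 (parityProj_mem (parUL n) parUL_parUL 1 x)]
      simp [sub_eq_add_neg]
    rw [this]
    exact I.sub_mem h0 h1
  · intro h p x hx
    rw [decompose_coe, parityProj_apply]
    exact Submodule.smul_of_tower_mem I _ (I.add_mem hx (Submodule.smul_of_tower_mem I _ (h x hx)))

/-- The finite dual `U_q(q_n)°`: the functionals whose kernel contains a cofinite `ℤ₂`-graded
(two-sided) ideal of `U_q(q_n)`. -/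
noncomputable def finiteDual (n : ℕ) : Submodule K (Module.Dual K (U n)) where
  carrier := {f | ∃ I : Ideal (U n), I.IsTwoSided ∧ I.IsHomogeneous (gradU n) ∧
    FiniteDimensional K (U n ⧸ I.restrictScalars K) ∧ ∀ x ∈ I, f x = 0}
  zero_mem' := ⟨⊤, inferInstance, fun _ _ _ => Submodule.mem_top,
    (Submodule.CoFG.top : (⊤ : Submodule K (U n)).CoFG), fun _ _ => rfl⟩
  add_mem' := by
    rintro f g ⟨I, hI1, hI2, hI3, hI4⟩ ⟨J, hJ1, hJ2, hJ3, hJ4⟩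
    refine ⟨I ⊓ J, ⟨fun b ha => ⟨hI1.mul_mem_of_left b ha.1, hJ1.mul_mem_of_left b ha.2⟩⟩,
      fun p x hx => ⟨hI2 p hx.1, hJ2 p hx.2⟩, ?_, fun x hx => ?_⟩
    · exact Submodule.CoFG.inf (S := I.restrictScalars K) (T := J.restrictScalars K) hI3 hJ3
    · rw [LinearMap.add_apply, hI4 x hx.1, hJ4 x hx.2, add_zero]
  smul_mem' := by
    rintro c f ⟨I, hI1, hI2, hI3, hI4⟩
    exact ⟨I, hI1, hI2, hI3, fun x hx => by rw [LinearMap.smul_apply, hI4 x hx, smul_zero]⟩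

/-- The parity involution of the finite dual; `f` has parity `p` if it vanishes on the elements of
parity `p + 1`. -/
noncomputable def parFD (n : ℕ) : finiteDual n →ₗ[K] finiteDual n :=
  (parUL n).dualMap.restrict fun f => by
    rintro ⟨I, hI1, hI2, hI3, hI4⟩
    exact ⟨I, hI1, hI2, hI3, fun x hx => hI4 _ ((isHomogeneous_iff I).1 hI2 x hx)⟩

/-- The pairing of `U_q(q_n)° ⊗ U_q(q_n)°` with `U_q(q_n) ⊗ U_q(q_n)`,
`⟨f ⊗ g, x ⊗ y⟩ = (-1)^{|x||y|} ⟨f, x⟩ ⟨g, y⟩`. (This is the Koszul sign `(-1)^{|g||x|}`, since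
`⟨g, y⟩ = 0` for `|g| ≠ |y|`.) -/
noncomputable def pairing (n : ℕ) :
    finiteDual n ⊗[K] finiteDual n →ₗ[K] Module.Dual K (U n ⊗[K] U n) :=
  (koszul (parUL n) (parUL n)).dualMap ∘ₗ TensorProduct.dualDistrib K (U n) (U n) ∘ₗ
    TensorProduct.map (finiteDual n).subtype (finiteDual n).subtype

theorem pairing_tmul {n : ℕ} (f g : finiteDual n) {p r : ZMod 2} {x y : U n} (hx : x ∈ gradU n p)
    (hy : y ∈ gradU n r) : pairing n (f ⊗ₜ g) (x ⊗ₜ y) = sgn (p * r) * (f.1 x * g.1 y) := by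
  simp only [pairing, LinearMap.comp_apply, LinearMap.dualMap_apply]
  rw [koszul_tmul _ _ hx hy, map_smul]
  simp

theorem pairing_injective (n : ℕ) : Function.Injective (pairing n) := by
  have : Module.Free K (finiteDual n) := Module.Free.of_divisionRing K (finiteDual n)
  have : Module.Free K (Module.Dual K (U n)) := Module.Free.of_divisionRing K _
  have h1 : Function.Injective
      (TensorProduct.map (finiteDual n).subtype (finiteDual n).subtype) :=
    TensorProduct.map_injective_of_flat_flat _ _ (Submodule.subtype_injective _)
      (Submodule.subtype_injective _)
  have h2 : Function.Injective (koszul (parUL n) (parUL n)).dualMap :=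
    LinearMap.dualMap_injective_of_surjective fun z =>
      ⟨koszul (parUL n) (parUL n) z, koszul_koszul parUL_parUL parUL_parUL z⟩
  exact h2.comp ((dualDistrib_injective _ _).comp h1)

/-- The comultiplication of `U_q(q_n)` as a linear map. -/
noncomputable def comulLin (n : ℕ) : U n →ₗ[K] U n ⊗[K] U n :=
  (GradedTensorProduct.of K (gradU n) (gradU n)).symm.toLinearMap ∘ₗ (comulU n).toLinearMap

theorem UU_induction {n : ℕ} {C : UU n → Prop} (z : UU n)
    (h : ∀ p r, ∀ x ∈ gradU n p, ∀ y ∈ gradU n r, C (tm x y)) (ha : ∀ z w, C z → C w → C (z + w)) :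
    C z := by
  have h0 : C 0 := by
    have := h 0 0 0 (Submodule.zero_mem _) 0 (Submodule.zero_mem _)
    simpa [tm, GradedTensorProduct.tmul] using this
  obtain ⟨z, rfl⟩ := (GradedTensorProduct.of K (gradU n) (gradU n)).surjective z
  induction z with
  | zero => simpa using h0
  | add x y hx hy => rw [map_add]; exact ha _ _ hx hy
  | tmul x y =>
    rw [← parityProj_add (parUL n) x, ← parityProj_add (parUL n) y]
    have hp := fun p (x : U n) => parityProj_mem (parUL n) parUL_parUL p x
    simp only [TensorProduct.add_tmul, TensorProduct.tmul_add, map_add]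
    exact ha _ _ (ha _ _ (h _ _ _ (hp 0 x) _ (hp 0 y)) (h _ _ _ (hp 1 x) _ (hp 0 y)))
      (ha _ _ (h _ _ _ (hp 0 x) _ (hp 1 y)) (h _ _ _ (hp 1 x) _ (hp 1 y)))

/-- Auxiliary: the subspace `I ⊗ U + U ⊗ J`. -/
noncomputable def tensorIdeal {n : ℕ} (I J : Ideal (U n)) : Submodule K (UU n) :=
  Submodule.span K {z | ∃ p r, ∃ x ∈ gradU n p, ∃ y ∈ gradU n r, (x ∈ I ∨ y ∈ J) ∧ z = tm x y}

theorem mul_mem_tensorIdeal {n : ℕ} {I J : Ideal (U n)} (u : UU n) {z : UU n}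
    (hz : z ∈ tensorIdeal I J) : u * z ∈ tensorIdeal I J := by
  induction hz using Submodule.span_induction with
  | zero => rw [mul_zero]; exact Submodule.zero_mem _
  | add x y _ _ hx hy => rw [mul_add]; exact Submodule.add_mem _ hx hy
  | smul c x _ hx => rw [mul_smul_comm]; exact Submodule.smul_mem _ _ hx
  | mem z hz =>
    obtain ⟨p, r, x, hx, y, hy, h, rfl⟩ := hz
    induction u using UU_induction with
    | ha u v hu hv => rw [add_mul]; exact Submodule.add_mem _ hu hv
    | h p' r' a ha b hb =>
      rw [tm_mul_tm _ _ hb hx]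
      refine Submodule.smul_mem _ _ (Submodule.subset_span ⟨_, _, _, SetLike.mul_mem_graded ha hx,
        _, SetLike.mul_mem_graded hb hy, ?_, rfl⟩)
      exact h.imp (fun h => I.mul_mem_left _ h) (fun h => J.mul_mem_left _ h)

theorem mem_tensorIdeal_mul {n : ℕ} {I J : Ideal (U n)} (hI : I.IsTwoSided) (hJ : J.IsTwoSided)
    (u : UU n) {z : UU n} (hz : z ∈ tensorIdeal I J) : z * u ∈ tensorIdeal I J := by
  induction hz using Submodule.span_induction with
  | zero => rw [zero_mul]; exact Submodule.zero_mem _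
  | add x y _ _ hx hy => rw [add_mul]; exact Submodule.add_mem _ hx hy
  | smul c x _ hx => rw [smul_mul_assoc]; exact Submodule.smul_mem _ _ hx
  | mem z hz =>
    obtain ⟨p, r, x, hx, y, hy, h, rfl⟩ := hz
    induction u using UU_induction with
    | ha u v hu hv => rw [mul_add]; exact Submodule.add_mem _ hu hv
    | h p' r' a ha b hb =>
      rw [tm_mul_tm _ _ hy ha]
      refine Submodule.smul_mem _ _ (Submodule.subset_span ⟨_, _, _, SetLike.mul_mem_graded hx ha,
        _, SetLike.mul_mem_graded hy hb, ?_, rfl⟩)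
      exact h.imp (fun h => hI.mul_mem_of_left _ h) (fun h => hJ.mul_mem_of_left _ h)

theorem tensorIdeal_cofinite {n : ℕ} {I J : Ideal (U n)} (hI : I.IsHomogeneous (gradU n))
    (hJ : J.IsHomogeneous (gradU n)) (h1 : FiniteDimensional K (U n ⧸ I.restrictScalars K))
    (h2 : FiniteDimensional K (U n ⧸ J.restrictScalars K)) :
    (tensorIdeal I J).CoFG := by
  let ψ : UU n →ₗ[K] (U n ⧸ I.restrictScalars K) ⊗[K] (U n ⧸ J.restrictScalars K) :=
    TensorProduct.map (I.restrictScalars K).mkQ (J.restrictScalars K).mkQ ∘ₗ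
      (GradedTensorProduct.of K (gradU n) (gradU n)).symm.toLinearMap
  have hp := fun p (x : U n) => parityProj_mem (parUL n) parUL_parUL p x
  have key : ∀ x y : U n, (x ∈ I ∨ y ∈ J) → (tm x y : UU n) ∈ tensorIdeal I J := by
    intro x y h
    have hpr : ∀ p r, (tm (parityProj (parUL n) p x) (parityProj (parUL n) r y) : UU n) ∈
        tensorIdeal I J := by
      intro p r
      refine Submodule.subset_span ⟨p, r, _, hp p x, _, hp r y, ?_, rfl⟩
      rw [← decompose_coe, ← decompose_coe]
      exact h.imp (fun h => hI p h) (fun h => hJ r h)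
    have : (tm x y : UU n) = ∑ p, ∑ r,
        tm (parityProj (parUL n) p x) (parityProj (parUL n) r y) := by
      simp only [← tm_sum_left, ← tm_sum_right, sum_zmod2, parityProj_add]
    rw [this]
    exact Submodule.sum_mem _ fun p _ => Submodule.sum_mem _ fun r _ => hpr p r
  have hle : LinearMap.ker ψ ≤ tensorIdeal I J := by
    intro z hz
    obtain ⟨z, rfl⟩ := (GradedTensorProduct.of K (gradU n) (gradU n)).surjective z
    have hz' : z ∈ LinearMap.ker
        (TensorProduct.map (I.restrictScalars K).mkQ (J.restrictScalars K).mkQ) := hz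
    rw [TensorProduct.map_ker (f := (I.restrictScalars K).subtype)
      (f' := (J.restrictScalars K).subtype)
      (LinearMap.exact_subtype_mkQ _) (Submodule.mkQ_surjective _)
      (LinearMap.exact_subtype_mkQ _) (Submodule.mkQ_surjective _)] at hz'
    refine (sup_le (c := (tensorIdeal I J).comap
      (GradedTensorProduct.of K (gradU n) (gradU n)).toLinearMap) ?_ ?_) hz'
    · rintro _ ⟨w, rfl⟩
      induction w with
      | zero => simp
      | add x y hx hy => rw [map_add]; exact Submodule.add_mem _ hx hy
      | tmul x y => exact key x y.1 (Or.inr y.2)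
    · rintro _ ⟨w, rfl⟩
      induction w with
      | zero => simp
      | add x y hx hy => rw [map_add]; exact Submodule.add_mem _ hx hy
      | tmul x y => exact key x.1 y (Or.inl x.2)
  exact Submodule.CoFG.of_le hle (Submodule.CoFG.ker ψ)

end FiniteDual

section FiniteDualStructure

/-- Auxiliary: the parity automorphism of `U_q(q_n) ⊗ U_q(q_n)`. -/
noncomputable def parUU (n : ℕ) : UU n →ₗ[K] UU n :=
  (GradedTensorProduct.of K (gradU n) (gradU n)).toLinearMap ∘ₗ
    TensorProduct.map (parUL n) (parUL n) ∘ₗ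
      (GradedTensorProduct.of K (gradU n) (gradU n)).symm.toLinearMap

theorem parUU_tm {n : ℕ} {p r : ZMod 2} {x y : U n} (hx : x ∈ gradU n p) (hy : y ∈ gradU n r) :
    parUU n (tm x y) = sgn (p + r) • tm x y := by
  have : parUU n (tm x y) = tm (parU n x) (parU n y) := rfl
  rw [this, mem_gradU.1 hx, mem_gradU.1 hy, tm_smul_left, tm_smul_right, smul_smul, sgn_add]

theorem parUU_mul {n : ℕ} (z w : UU n) : parUU n (z * w) = parUU n z * parUU n w := by
  induction z using UU_induction with
  | ha u v hu hv => rw [add_mul, map_add, map_add, add_mul, hu, hv]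
  | h p r x hx y hy =>
    induction w using UU_induction with
    | ha u v hu hv => rw [mul_add, map_add, map_add, mul_add, hu, hv]
    | h p' r' x' hx' y' hy' =>
      rw [tm_mul_tm _ _ hy hx', map_smul,
        parUU_tm (SetLike.mul_mem_graded hx hx') (SetLike.mul_mem_graded hy hy'), parUU_tm hx hy,
        parUU_tm hx' hy', smul_mul_smul_comm, tm_mul_tm _ _ hy hx', smul_comm, ← sgn_add]
      congr 2
      ring

theorem comulU_parU {n : ℕ} (x : U n) : comulU n (parU n x) = parUU n (comulU n x) := by
  let P : UU n →ₐ[K] UU n := AlgHom.ofLinearMap (parUU n) (by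
    have h1 : (1 : U n) ∈ gradU n 0 := mem_gradU.2 (by simp)
    have : (1 : UU n) = tm 1 1 := rfl
    rw [this, parUU_tm h1 h1]; simp) parUU_mul
  have : (comulU n).comp (parU n) = P.comp (comulU n) := by
    apply U.hom_ext
    intro i j
    rw [AlgHom.comp_apply, AlgHom.comp_apply, parU_L, map_smul, comulU_L]
    change _ = parUU n (coprL i j)
    rw [coprL, map_sum, Finset.smul_sum]
    refine Finset.sum_congr rfl fun k _ => ?_
    rw [map_smul, parUU_tm (L_mem i k) (L_mem k j), smul_comm]
    congr 3
    have := CharTwo.add_self_eq_zero (par k)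
    linear_combination -this
  exact DFunLike.congr_fun this x

theorem mul_mem_finiteDual {n : ℕ} (z : finiteDual n ⊗[K] finiteDual n) :
    (comulLin n).dualMap (pairing n z) ∈ finiteDual n := by
  induction z with
  | zero => rw [map_zero, map_zero]; exact Submodule.zero_mem _
  | add x y hx hy => rw [map_add, map_add]; exact Submodule.add_mem _ hx hy
  | tmul f g =>
    obtain ⟨f, I, hI1, hI2, hI3, hI4⟩ := f
    obtain ⟨g, J, hJ1, hJ2, hJ3, hJ4⟩ := g
    let N : Ideal (U n) :=
      { carrier := {x | comulU n x ∈ tensorIdeal I J}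
        add_mem' := fun {x y} hx hy => by
          simp only [Set.mem_ofPred_eq] at *; rw [map_add]; exact Submodule.add_mem _ hx hy
        zero_mem' := by simp only [Set.mem_ofPred_eq]; rw [map_zero]; exact Submodule.zero_mem _
        smul_mem' := fun c x hx => by
          simp only [Set.mem_ofPred_eq, smul_eq_mul] at *
          rw [map_mul]; exact mul_mem_tensorIdeal _ hx }
    refine ⟨N, ⟨fun {x} b hx => ?_⟩, (isHomogeneous_iff N).2 fun x hx => ?_, ?_, fun x hx => ?_⟩
    · change comulU n (x * b) ∈ tensorIdeal I J
      rw [map_mul]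
      exact mem_tensorIdeal_mul hI1 hJ1 _ hx
    · change comulU n (parU n x) ∈ tensorIdeal I J
      rw [comulU_parU]
      have hx' : comulU n x ∈ tensorIdeal I J := hx
      generalize comulU n x = z at hx'
      induction hx' using Submodule.span_induction with
      | zero => rw [map_zero]; exact Submodule.zero_mem _
      | add x y _ _ hx hy => rw [map_add]; exact Submodule.add_mem _ hx hy
      | smul c x _ hx => rw [map_smul]; exact Submodule.smul_mem _ _ hx
      | mem z hz =>
        obtain ⟨p, r, x, hx, y, hy, h, rfl⟩ := hz
        rw [parUU_tm hx hy]
        exact Submodule.smul_mem _ _ (Submodule.subset_span ⟨_, _, _, hx, _, hy, h, rfl⟩)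
    · let φ : U n →ₗ[K] UU n ⧸ tensorIdeal I J := (tensorIdeal I J).mkQ ∘ₗ (comulU n).toLinearMap
      have := tensorIdeal_cofinite hI2 hJ2 hI3 hJ3
      have h := Submodule.CoFG.ker φ
      have e : LinearMap.ker φ = N.restrictScalars K := by
        ext x
        simp only [φ, LinearMap.mem_ker, LinearMap.comp_apply, Submodule.mkQ_apply,
          Submodule.Quotient.mk_eq_zero]
        rfl
      rw [e] at h
      exact h
    · have hx' : comulU n x ∈ tensorIdeal I J := hx
      rw [LinearMap.dualMap_apply]
      change pairing n _ ((GradedTensorProduct.of K (gradU n) (gradU n)).symm (comulU n x)) = 0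
      generalize comulU n x = z at hx'
      induction hx' using Submodule.span_induction with
      | zero => rw [map_zero, map_zero]
      | add x y _ _ hx hy => rw [map_add, map_add, hx, hy, add_zero]
      | smul c x _ hx => rw [map_smul, map_smul, hx, smul_zero]
      | mem z hz =>
        obtain ⟨p, r, x, hx, y, hy, h, rfl⟩ := hz
        refine (pairing_tmul _ _ hx hy).trans ?_
        rcases h with h | h
        · rw [hI4 x h, zero_mul, mul_zero]
        · rw [hJ4 y h, mul_zero, mul_zero]

/-- The multiplication of the finite dual: `⟨f g, x⟩ = ⟨f ⊗ g, Δ(x)⟩`. -/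
noncomputable def mulFD (n : ℕ) : finiteDual n →ₗ[K] finiteDual n →ₗ[K] finiteDual n :=
  TensorProduct.curry (LinearMap.codRestrict (finiteDual n) ((comulLin n).dualMap ∘ₗ pairing n)
    mul_mem_finiteDual)

theorem mulFD_apply {n : ℕ} (f g : finiteDual n) (x : U n) :
    (mulFD n f g).1 x = pairing n (f ⊗ₜ g) (comulLin n x) := rfl

theorem ker_mem_finiteDual {n : ℕ} {A : Type*} [Ring A] [Algebra K A] [FiniteDimensional K A]
    (ρ : U n →ₐ[K] A) (hρ : ∀ x, ρ x = 0 → ρ (parU n x) = 0) (φ : A →ₗ[K] K) :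
    φ ∘ₗ ρ.toLinearMap ∈ finiteDual n := by
  refine ⟨RingHom.ker ρ, inferInstance, (isHomogeneous_iff _).2 hρ,
    Submodule.CoFG.ker ρ.toLinearMap, fun x hx => ?_⟩
  rw [LinearMap.comp_apply]
  have : ρ x = 0 := hx
  rw [AlgHom.toLinearMap_apply, this, map_zero]

theorem counitU_parU {n : ℕ} (x : U n) : counitU n (parU n x) = counitU n x := by
  have : (counitU n).comp (parU n) = counitU n := by
    apply U.hom_ext
    intro i j
    rw [AlgHom.comp_apply, parU_L, map_smul, counitU_L]
    split_ifs with h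
    · subst h; simp [CharTwo.add_self_eq_zero]
    · simp
  exact DFunLike.congr_fun this x

/-- The unit of the finite dual, which is the counit of `U_q(q_n)`. -/
noncomputable def oneFD (n : ℕ) : finiteDual n :=
  ⟨(counitU n).toLinearMap, by
    have := ker_mem_finiteDual (counitU n) (fun x hx => by rw [counitU_parU, hx]) LinearMap.id
    exact this⟩

/-- The counit of the finite dual: evaluation at `1`. -/
noncomputable def counitFD (n : ℕ) : finiteDual n →ₗ[K] K :=
  Module.Dual.eval K (U n) 1 ∘ₗ (finiteDual n).subtype

theorem counitFD_apply {n : ℕ} (f : finiteDual n) : counitFD n f = f.1 1 := rfl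

theorem mul_dual_mem_range {n : ℕ} (f : finiteDual n) :
    (LinearMap.mul' K (U n)).dualMap f.1 ∈ LinearMap.range (pairing n) := by
  obtain ⟨f, I, hI1, hI2, hI3, hI4⟩ := f
  let I' := I.restrictScalars K
  let π := TensorProduct.map I'.mkQ I'.mkQ
  let κ := koszul (parUL n) (parUL n)
  let G : Module.Dual K (U n ⊗[K] U n) := κ.dualMap ((LinearMap.mul' K (U n)).dualMap f)
  have hG : ∀ x y : U n, (x ∈ I ∨ y ∈ I) → G (x ⊗ₜ y) = 0 := by
    intro x y h
    change f (LinearMap.mul' K (U n) (κ (x ⊗ₜ y))) = 0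
    simp only [κ, koszul, LinearMap.sum_apply, LinearMap.smul_apply, TensorProduct.map_tmul,
      map_sum, map_smul, LinearMap.mul'_apply]
    refine Finset.sum_eq_zero fun p _ => Finset.sum_eq_zero fun r _ => ?_
    rw [hI4, smul_zero]
    rw [← decompose_coe, ← decompose_coe]
    rcases h with h | h
    · exact hI1.mul_mem_of_left _ (hI2 p h)
    · exact I.mul_mem_left _ (hI2 r h)
  have hker : LinearMap.ker π ≤ LinearMap.ker G := by
    rw [TensorProduct.map_ker (f := I'.subtype) (f' := I'.subtype)
      (LinearMap.exact_subtype_mkQ _) (Submodule.mkQ_surjective _)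
      (LinearMap.exact_subtype_mkQ _) (Submodule.mkQ_surjective _)]
    refine sup_le ?_ ?_
    · rintro _ ⟨w, rfl⟩
      induction w with
      | zero => simp
      | add x y hx hy => rw [map_add]; exact Submodule.add_mem _ hx hy
      | tmul x y => exact hG x y.1 (Or.inr y.2)
    · rintro _ ⟨w, rfl⟩
      induction w with
      | zero => simp
      | add x y hx hy => rw [map_add]; exact Submodule.add_mem _ hx hy
      | tmul x y => exact hG x.1 y (Or.inl x.2)
  have hπ : Function.Surjective π :=
    TensorProduct.map_surjective (Submodule.mkQ_surjective _) (Submodule.mkQ_surjective _)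
  obtain ⟨s, hs⟩ := π.exists_rightInverse_of_surjective (LinearMap.range_eq_top.2 hπ)
  have hFG : ∀ z, (G ∘ₗ s) (π z) = G z := by
    intro z
    have h1 : s (π z) - z ∈ LinearMap.ker π := by
      rw [LinearMap.mem_ker, map_sub, ← LinearMap.comp_apply, hs, LinearMap.id_apply, sub_self]
    have h2 := hker h1
    rw [LinearMap.mem_ker, map_sub, sub_eq_zero] at h2
    exact h2
  let ι : Module.Dual K (U n ⧸ I') →ₗ[K] finiteDual n :=
    LinearMap.codRestrict (finiteDual n) I'.mkQ.dualMap fun φ =>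
      ⟨I, hI1, hI2, hI3, fun x hx => by
        rw [LinearMap.dualMap_apply, (Submodule.mkQ_apply _ _), (Submodule.Quotient.mk_eq_zero I').2 hx,
          map_zero]⟩
  have : FiniteDimensional K (U n ⧸ I') := hI3
  have : Module.Free K (U n ⧸ I') := Module.Free.of_divisionRing K _
  let w0 := (TensorProduct.dualDistribEquiv K (U n ⧸ I') (U n ⧸ I')).symm (G ∘ₗ s)
  refine ⟨TensorProduct.map ι ι w0, ?_⟩
  have key : ∀ w : Module.Dual K (U n ⧸ I') ⊗[K] Module.Dual K (U n ⧸ I'),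
      pairing n (TensorProduct.map ι ι w) =
        κ.dualMap (π.dualMap (TensorProduct.dualDistrib K _ _ w)) := by
    intro w
    simp only [pairing, LinearMap.comp_apply]
    refine congrArg κ.dualMap ?_
    induction w with
    | zero => simp
    | add x y hx hy => simp only [map_add, hx, hy]
    | tmul φ φ' =>
      apply TensorProduct.ext'
      intro x y
      rfl
  rw [key]
  have hw : TensorProduct.dualDistrib K _ _ w0 = G ∘ₗ s :=
    (TensorProduct.dualDistribEquiv K (U n ⧸ I') (U n ⧸ I')).apply_symm_apply _
  rw [hw]
  have : π.dualMap (G ∘ₗ s) = G := LinearMap.ext hFG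
  rw [this]
  apply LinearMap.ext
  intro z
  change f (LinearMap.mul' K (U n) (κ (κ z))) = f (LinearMap.mul' K (U n) z)
  rw [koszul_koszul parUL_parUL parUL_parUL]

/-- The comultiplication of the finite dual, characterized by `⟨Δ°(f), x ⊗ y⟩ = ⟨f, x y⟩`. -/
noncomputable def comulFD (n : ℕ) : finiteDual n →ₗ[K] finiteDual n ⊗[K] finiteDual n :=
  (LinearEquiv.ofInjective (pairing n) (pairing_injective n)).symm.toLinearMap ∘ₗ
    LinearMap.codRestrict (LinearMap.range (pairing n))
      ((LinearMap.mul' K (U n)).dualMap ∘ₗ (finiteDual n).subtype) mul_dual_mem_range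

theorem pairing_comulFD {n : ℕ} (f : finiteDual n) (x y : U n) :
    pairing n (comulFD n f) (x ⊗ₜ y) = f.1 (x * y) := by
  have := congrArg Subtype.val ((LinearEquiv.ofInjective (pairing n) (pairing_injective n)).apply_symm_apply
    (LinearMap.codRestrict (LinearMap.range (pairing n))
      ((LinearMap.mul' K (U n)).dualMap ∘ₗ (finiteDual n).subtype) mul_dual_mem_range f))
  exact LinearMap.congr_fun this (x ⊗ₜ y)

theorem vecRep_parU {n : ℕ} (x : U n) (a b : Idx n) :
    vecRep n (parU n x) a b = sgn (par a + par b) * vecRep n x a b := by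
  let D : Matrix (Idx n) (Idx n) K := Matrix.diagonal fun a => sgn (par a)
  have hD : D * D = 1 := by
    simp [D, Matrix.diagonal_mul_diagonal]
  let c : Matrix (Idx n) (Idx n) K →ₐ[K] Matrix (Idx n) (Idx n) K := AlgHom.ofLinearMap
    (LinearMap.mulLeft K D ∘ₗ LinearMap.mulRight K D)
    (by simp [hD])
    (fun X Y => by
      simp only [LinearMap.comp_apply, LinearMap.mulLeft_apply, LinearMap.mulRight_apply]
      calc D * (X * Y * D) = D * X * 1 * Y * D := by simp only [mul_one, mul_assoc]
        _ = _ := by rw [← hD]; simp only [mul_assoc])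
  have hc : ∀ X : Matrix (Idx n) (Idx n) K, ∀ a b, c X a b = sgn (par a + par b) * X a b := by
    intro X a b
    change (D * (X * D)) a b = _
    rw [Matrix.diagonal_mul, Matrix.mul_diagonal, sgn_add]
    ring
  have h : (vecRep n).comp (parU n) = c.comp (vecRep n) := by
    apply U.hom_ext
    intro i j
    ext a b
    rw [AlgHom.comp_apply, AlgHom.comp_apply, parU_L, map_smul, hc, Matrix.smul_apply, vecRep_L,
      smul_eq_mul]
    by_cases h0 : par a + par b + (par i + par j) = 0
    · have : par i + par j = par a + par b := by
        generalize par a = a, par b = b, par i = i, par j = j at h0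
        revert a b i j; decide
      rw [this]
    · rw [Smat_even _ _ _ _ h0]; simp
  have := DFunLike.congr_fun h x
  rw [AlgHom.comp_apply, AlgHom.comp_apply] at this
  rw [this, hc]

/-- The matrix element `t_{ab}` of the vector supermodule: `x v_b = ∑_a ⟨t_{ab}, x⟩ v_a`. -/
noncomputable def tElt {n : ℕ} (a b : Idx n) : finiteDual n :=
  ⟨Matrix.entryLinearMap K K a b ∘ₗ (vecRep n).toLinearMap,
    ker_mem_finiteDual (vecRep n) (fun x hx => by
      ext a b
      rw [vecRep_parU, hx]
      simp) _⟩

theorem tElt_apply {n : ℕ} (a b : Idx n) (x : U n) : (tElt a b).1 x = vecRep n x a b := rfl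

/-- The quantum coordinate superalgebra `A_q(q_n)`: the sub-superalgebra of the finite dual
generated by the `t_{ab}`, i.e. the smallest `ℤ₂`-graded subspace which contains the unit and the
`t_{ab}` and is closed under multiplication. -/
noncomputable def coordAlg (n : ℕ) : Submodule K (finiteDual n) :=
  sInf {A | (∀ f ∈ A, parFD n f ∈ A) ∧ oneFD n ∈ A ∧ (∀ a b, tElt a b ∈ A) ∧
    ∀ f ∈ A, ∀ g ∈ A, mulFD n f g ∈ A}

end FiniteDualStructure

/-! ### Bi-superalgebras -/

section Bisuperalgebra

variable {M : Type*} [AddCommGroup M] [Module K M]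

/-- The multiplication of the tensor product of a superalgebra with itself:
`(x ⊗ y) (x' ⊗ y') = (-1)^{|y||x'|} x x' ⊗ y y'`. -/
noncomputable def tensorMul (γ : M →ₗ[K] M) (mul : M →ₗ[K] M →ₗ[K] M) :
    M ⊗[K] M →ₗ[K] M ⊗[K] M →ₗ[K] M ⊗[K] M :=
  ∑ p : ZMod 2, ∑ r : ZMod 2, sgn (p * r) •
    TensorProduct.map₂ (mul.compl₂ (parityProj γ r)) (mul ∘ₗ parityProj γ p)

/-- A bi-superalgebra over `K`, with parity involution `γ`. -/
structure IsBisuperalgebra (γ : M →ₗ[K] M) (mul : M →ₗ[K] M →ₗ[K] M) (one : M)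
    (comul : M →ₗ[K] M ⊗[K] M) (counit : M →ₗ[K] K) : Prop where
  par_par : ∀ x, γ (γ x) = x
  par_mul : ∀ x y, γ (mul x y) = mul (γ x) (γ y)
  par_one : γ one = one
  par_comul : ∀ x, comul (γ x) = TensorProduct.map γ γ (comul x)
  par_counit : ∀ x, counit (γ x) = counit x
  mul_assoc : ∀ x y z, mul (mul x y) z = mul x (mul y z)
  one_mul : ∀ x, mul one x = x
  mul_one : ∀ x, mul x one = x
  coassoc : ∀ x, TensorProduct.assoc K M M M (comul.rTensor M (comul x)) =
    comul.lTensor M (comul x)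
  counit_left : ∀ x, TensorProduct.lid K M (counit.rTensor M (comul x)) = x
  counit_right : ∀ x, TensorProduct.rid K M (counit.lTensor M (comul x)) = x
  comul_mul : ∀ x y, comul (mul x y) = tensorMul γ mul (comul x) (comul y)
  comul_one : comul one = one ⊗ₜ one
  counit_mul : ∀ x y, counit (mul x y) = counit x * counit y
  counit_one : counit one = 1

/-- A sub-bi-superalgebra: a `ℤ₂`-graded subspace `A` containing the unit, closed under
multiplication and with `Δ(A) ⊆ A ⊗ A`. -/
structure IsSubBisuperalgebra (γ : M →ₗ[K] M) (mul : M →ₗ[K] M →ₗ[K] M) (one : M)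
    (comul : M →ₗ[K] M ⊗[K] M) (A : Submodule K M) : Prop where
  par_mem : ∀ x ∈ A, γ x ∈ A
  one_mem : one ∈ A
  mul_mem : ∀ x ∈ A, ∀ y ∈ A, mul x y ∈ A
  comul_mem : ∀ x ∈ A, comul x ∈ LinearMap.range (TensorProduct.map A.subtype A.subtype)

/-- The multiplication of the superalgebra `End V ⊗ End V ⊗ M` for a superalgebra `M`. The element
`∑ E_{ab} ⊗ E_{cd} ⊗ X_{abcd}` is given by its coefficients, and
`(E_{ab} ⊗ E_{cd} ⊗ m) (E_{bj} ⊗ E_{dl} ⊗ m') =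
  (-1)^{|E_{cd}||E_{bj}| + |m|(|E_{bj}| + |E_{dl}|)} E_{aj} ⊗ E_{cl} ⊗ m m'`. -/
noncomputable def mulEE {n : ℕ} (γ : M →ₗ[K] M) (mul : M →ₗ[K] M →ₗ[K] M)
    (X Y : Idx n → Idx n → Idx n → Idx n → M) (a j c l : Idx n) : M :=
  ∑ b, ∑ d, ∑ p : ZMod 2,
    (sgn ((par c + par d) * (par b + par j)) * sgn (p * (par b + par j + (par d + par l)))) •
      mul (parityProj γ p (X a b c d)) (Y b j d l)

/-- `S¹² = S ⊗ 1` in `End V ⊗ End V ⊗ U_q(q_n)°`. -/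
noncomputable def S12 (n : ℕ) (a b c d : Idx n) : finiteDual n := Smat a b c d • oneFD n

/-- `T¹³ = ∑ E_{ab} ⊗ 1 ⊗ t_{ab}`, where `T = ∑ E_{ab} ⊗ t_{ab}`. -/
noncomputable def T13 (n : ℕ) (a b c d : Idx n) : finiteDual n := if c = d then tElt a b else 0

/-- `T²³ = ∑ 1 ⊗ E_{cd} ⊗ t_{cd}`. -/
noncomputable def T23 (n : ℕ) (a b c d : Idx n) : finiteDual n := if a = b then tElt c d else 0

end Bisuperalgebra

end QueerSuper

/-! The structure maps of the finite dual are transposes of those of U, so its axioms are the axioms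
of U read backwards. The pairing of U° ⊗ U° with U ⊗ U is injective (`pairing_injective`), and so is
its analogue on tensor cubes (`triplePairing_injective`). Identities can therefore be tested by
evaluation at homogeneous elements.

Only the Koszul signs need care. A functional of parity p vanishes on elements of the other parity,
so the sign in ⟨f ⊗ g, x ⊗ y⟩ can be read off from the functionals (`pairing_tmul_of_parity`) or
from the arguments (`pairing_eq_pairing₀`). The first reading turns products into sign-free
evaluations on Δ(x), the second turns coproducts into sign-free evaluations of f(xy). Associativity
and unit then come from coassociativity and counit of U, coassociativity and counit from
associativity and unit of U, and multiplicativity of Δ° (`comulFD_mulFD`) from that of Δ. The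
coalgebra axioms of U hold because both sides are multiplicative for the signed products, so that
the generators suffice (`comulLin_coassoc`, `comulLin_counit_left`, `comulLin_counit_right`).

The t_{ab} are matrix coefficients of a representation, which gives Δ°(t_{ab}). Hence the elements
of A whose coproduct lies in A ⊗ A form a graded subalgebra containing all generators, that is, all
of A (`comulFD_mem_coordAlg`). The symmetry t_{ab} = t_{-a,-b} says that U commutes with the
exchange of v_i and v_{-i}; this holds because S does in its first factor (`Smat_neg_neg`).

The RTT relation, evaluated at x, says that S followed by the graded flip commutes with the action
of x on V ⊗ V (`signedS_mul_tensorSquareMat`). The x with this property form a subalgebra. For x =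
L_{ik} it is the Yang–Baxter equation of S, which is also what makes V a module (`matL_rll`). -/

namespace QueerSuper

/-! ### Tensor products of superspaces and superalgebras -/

section SuperTensor

variable {M N : Type*} [AddCommGroup M] [Module K M] [AddCommGroup N] [Module K N]

/-- The multiplication `(x ⊗ y) (x' ⊗ y') = (-1)^{|y||x'|} x x' ⊗ y y'` of the tensor product of
two superalgebras. -/
noncomputable def superMul (γ : M →ₗ[K] M) (γ' : N →ₗ[K] N) (mul : M →ₗ[K] M →ₗ[K] M)
    (mul' : N →ₗ[K] N →ₗ[K] N) : M ⊗[K] N →ₗ[K] M ⊗[K] N →ₗ[K] M ⊗[K] N :=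
  ∑ p : ZMod 2, ∑ r : ZMod 2, sgn (p * r) •
    TensorProduct.map₂ (mul.compl₂ (parityProj γ r)) (mul' ∘ₗ parityProj γ' p)

theorem superMul_tmul {γ : M →ₗ[K] M} {γ' : N →ₗ[K] N} {mul : M →ₗ[K] M →ₗ[K] M}
    {mul' : N →ₗ[K] N →ₗ[K] N} {p r : ZMod 2} (x : M) {y : N} {x' : M} (y' : N)
    (hy : y ∈ parityPart γ' p) (hx' : x' ∈ parityPart γ r) :
    superMul γ γ' mul mul' (x ⊗ₜ y) (x' ⊗ₜ y') = sgn (p * r) • (mul x x' ⊗ₜ[K] mul' y y') := by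
  simp only [superMul, LinearMap.sum_apply, LinearMap.smul_apply, TensorProduct.map₂_apply_tmul,
    LinearMap.comp_apply, parityProj_of_mem γ' hy]
  rw [Finset.sum_eq_single p, Finset.sum_eq_single r]
  · simp [parityProj_of_mem γ hx']
  · intro b _ hb; simp [parityProj_of_mem γ hx', hb]
  · simp
  · intro b _ hb; simp [hb]
  · simp

theorem tmul_mem_parityPart {γ : M →ₗ[K] M} {γ' : N →ₗ[K] N} {p r : ZMod 2} {x : M} {y : N}
    (hx : x ∈ parityPart γ p) (hy : y ∈ parityPart γ' r) :
    x ⊗ₜ[K] y ∈ parityPart (TensorProduct.map γ γ') (p + r) := by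
  rw [mem_parityPart] at *
  rw [TensorProduct.map_tmul, hx, hy, TensorProduct.smul_tmul_smul, sgn_add]

/-- A tensor is a sum of tensors `x ⊗ y` with homogeneous `x` and `y`. -/
theorem tensor_induction_parity {γ : M →ₗ[K] M} {γ' : N →ₗ[K] N} (h : ∀ x, γ (γ x) = x)
    (h' : ∀ x, γ' (γ' x) = x) {C : M ⊗[K] N → Prop} (z : M ⊗[K] N)
    (H : ∀ p r, ∀ x ∈ parityPart γ p, ∀ y ∈ parityPart γ' r, C (x ⊗ₜ y))
    (ha : ∀ z w, C z → C w → C (z + w)) : C z := by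
  induction z with
  | zero =>
    have := H 0 0 0 (Submodule.zero_mem _) 0 (Submodule.zero_mem _)
    rwa [TensorProduct.zero_tmul] at this
  | add x y hx hy => exact ha _ _ hx hy
  | tmul x y =>
    rw [← parityProj_add γ x, ← parityProj_add γ' y]
    have hp := parityProj_mem γ h
    have hp' := parityProj_mem γ' h'
    simp only [TensorProduct.add_tmul, TensorProduct.tmul_add]
    exact ha _ _ (ha _ _ (H _ _ _ (hp 0 x) _ (hp' 0 y)) (H _ _ _ (hp 1 x) _ (hp' 0 y)))
      (ha _ _ (H _ _ _ (hp 0 x) _ (hp' 1 y)) (H _ _ _ (hp 1 x) _ (hp' 1 y)))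

/-- A tensor of parity `s` is a sum of tensors `x ⊗ y` with homogeneous `x` and `y` of total
parity `s`. -/
theorem parityPart_tensor_induction {γ : M →ₗ[K] M} {γ' : N →ₗ[K] N} (h : ∀ x, γ (γ x) = x)
    (h' : ∀ x, γ' (γ' x) = x) {C : M ⊗[K] N → Prop} {s : ZMod 2} {z : M ⊗[K] N}
    (hz : z ∈ parityPart (TensorProduct.map γ γ') s)
    (H : ∀ p r, p + r = s → ∀ x ∈ parityPart γ p, ∀ y ∈ parityPart γ' r, C (x ⊗ₜ y))
    (ha : ∀ z w, C z → C w → C (z + w)) : C z := by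
  -- The projection to parity s keeps or kills each homogeneous pure tensor, and z is its own
  -- projection.
  have key : ∀ w, C (parityProj (TensorProduct.map γ γ') s w) := by
    intro w
    induction w using tensor_induction_parity h h' with
    | H p r x hx y hy =>
      rw [parityProj_of_mem _ (tmul_mem_parityPart hx hy)]
      split_ifs with e
      · exact H p r e.symm x hx y hy
      · have := H s 0 (add_zero s) 0 (Submodule.zero_mem _) 0 (Submodule.zero_mem _)
        rwa [TensorProduct.zero_tmul] at this
    | ha z w hz hw => rw [map_add]; exact ha _ _ hz hw
  have := key z
  rwa [parityProj_of_mem _ hz, if_pos rfl] at this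

theorem map_map_self {γ : M →ₗ[K] M} {γ' : N →ₗ[K] N} (h : ∀ x, γ (γ x) = x)
    (h' : ∀ x, γ' (γ' x) = x) (z : M ⊗[K] N) :
    TensorProduct.map γ γ' (TensorProduct.map γ γ' z) = z := by
  induction z with
  | zero => simp
  | add x y hx hy => simp only [map_add, hx, hy]
  | tmul x y => simp only [TensorProduct.map_tmul, h, h']

/-- The multiplication of the tensor cube of a superalgebra. -/
noncomputable def superMul₃ (γ : M →ₗ[K] M) (mul : M →ₗ[K] M →ₗ[K] M) :
    M ⊗[K] (M ⊗[K] M) →ₗ[K] M ⊗[K] (M ⊗[K] M) →ₗ[K] M ⊗[K] (M ⊗[K] M) :=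
  superMul γ (TensorProduct.map γ γ) mul (superMul γ γ mul mul)

variable {γ : M →ₗ[K] M} {mul : M →ₗ[K] M →ₗ[K] M} {Δ : M →ₗ[K] M ⊗[K] M}

/-- Because Δ is even, Δ(y) has the parity of y, so moving it past x' costs the same sign before and
after applying 1 ⊗ Δ. -/
theorem lTensor_superMul (h : ∀ x, γ (γ x) = x)
    (hΔγ : ∀ x, Δ (γ x) = TensorProduct.map γ γ (Δ x))
    (hΔ : ∀ x y, Δ (mul x y) = superMul γ γ mul mul (Δ x) (Δ y)) (z w : M ⊗[K] M) :
    Δ.lTensor M (superMul γ γ mul mul z w) =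
      superMul₃ γ mul (Δ.lTensor M z) (Δ.lTensor M w) := by
  induction z using tensor_induction_parity h h with
  | ha z w hz hw => simp only [map_add, LinearMap.add_apply, hz, hw]
  | H p r x hx y hy =>
    induction w using tensor_induction_parity h h with
    | ha z w hz hw => simp only [map_add, hz, hw]
    | H p' r' x' hx' y' hy' =>
      have hy2 : Δ y ∈ parityPart (TensorProduct.map γ γ) r := by
        rw [mem_parityPart] at *
        rw [← hΔγ, hy, map_smul]
      rw [superMul_tmul _ _ hy hx', map_smul, LinearMap.lTensor_tmul, LinearMap.lTensor_tmul,
        LinearMap.lTensor_tmul, superMul₃, superMul_tmul _ _ hy2 hx', hΔ]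

/-- Multiplicativity of the associator: on the left y passes the two legs of w one after the other,
on the right it passes w at once, and the total sign depends only on the parity of w. -/
theorem superMul₃_assoc (h : ∀ x, γ (γ x) = x) {p r : ZMod 2} (z : M ⊗[K] M) {w : M ⊗[K] M}
    {y : M} (y' : M) (hw : w ∈ parityPart (TensorProduct.map γ γ) r) (hy : y ∈ parityPart γ p) :
    superMul₃ γ mul (TensorProduct.assoc K M M M (z ⊗ₜ y))
      (TensorProduct.assoc K M M M (w ⊗ₜ y')) =
    sgn (p * r) • TensorProduct.assoc K M M M (superMul γ γ mul mul z w ⊗ₜ mul y y') := by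
  induction z using tensor_induction_parity h h with
  | ha z w hz hw =>
    simp only [map_add, LinearMap.add_apply, TensorProduct.add_tmul, hz, hw, smul_add]
  | H a b x hx x₂ hx₂ =>
    -- The decomposition of w keeps the total parity r, since the sign `sgn (p * r)` must be the
    -- same for all pieces.
    refine parityPart_tensor_induction (C := fun w => superMul₃ γ mul
      (TensorProduct.assoc K M M M ((x ⊗ₜ x₂) ⊗ₜ y)) (TensorProduct.assoc K M M M (w ⊗ₜ y')) =
      sgn (p * r) • TensorProduct.assoc K M M M
        (superMul γ γ mul mul (x ⊗ₜ x₂) w ⊗ₜ mul y y')) h h hw ?_ fun z w hz hw => ?_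
    · intro a' b' e x' hx' x₂' hx₂'
      rw [TensorProduct.assoc_tmul, TensorProduct.assoc_tmul, superMul₃,
        superMul_tmul _ _ (tmul_mem_parityPart hx₂ hy) hx', superMul_tmul _ _ hy hx₂',
        superMul_tmul _ _ hx₂ hx', TensorProduct.tmul_smul, ← TensorProduct.smul_tmul', map_smul,
        TensorProduct.assoc_tmul, smul_smul, smul_smul, ← sgn_add, ← sgn_add, ← e]
      congr 2
      ring
    · simp only [map_add, TensorProduct.add_tmul, hz, hw, smul_add]

theorem assoc_rTensor_superMul (h : ∀ x, γ (γ x) = x)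
    (hΔγ : ∀ x, Δ (γ x) = TensorProduct.map γ γ (Δ x))
    (hΔ : ∀ x y, Δ (mul x y) = superMul γ γ mul mul (Δ x) (Δ y)) (z w : M ⊗[K] M) :
    TensorProduct.assoc K M M M (Δ.rTensor M (superMul γ γ mul mul z w)) =
      superMul₃ γ mul (TensorProduct.assoc K M M M (Δ.rTensor M z))
        (TensorProduct.assoc K M M M (Δ.rTensor M w)) := by
  induction z using tensor_induction_parity h h with
  | ha z w hz hw => simp only [map_add, LinearMap.add_apply, hz, hw]
  | H p r x hx y hy =>
    induction w using tensor_induction_parity h h with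
    | ha z w hz hw => simp only [map_add, hz, hw]
    | H p' r' x' hx' y' hy' =>
      have hx2 : Δ x' ∈ parityPart (TensorProduct.map γ γ) p' := by
        rw [mem_parityPart] at *
        rw [← hΔγ, hx', map_smul]
      rw [superMul_tmul _ _ hy hx', map_smul, map_smul, LinearMap.rTensor_tmul,
        LinearMap.rTensor_tmul, LinearMap.rTensor_tmul, superMul₃_assoc h _ _ hx2 hy, hΔ]

end SuperTensor

/-! ### The coalgebra structure of the quantum queer superalgebra -/

section Coalgebra

variable {n : ℕ}

theorem U.induction {C : U n → Prop} (x : U n) (h1 : C 1) (hL : ∀ i j, C (L i j))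
    (hs : ∀ (c : K) x, C x → C (c • x)) (ha : ∀ x y, C x → C y → C (x + y))
    (hm : ∀ x y, C x → C y → C (x * y)) : C x := by
  obtain ⟨x, rfl⟩ := RingQuot.mkAlgHom_surjective K (Rel n) x
  induction x using FreeAlgebra.induction with
  | grade0 c =>
    rw [Algebra.algebraMap_eq_smul_one, map_smul, map_one]
    exact hs c _ h1
  | grade1 g =>
    have := hL g.1.1 g.1.2
    simp only [L, letter, dif_pos g.2] at this
    exact this
  | mul a b ha hb => rw [map_mul]; exact hm _ _ ha hb
  | add a b ha' hb => rw [map_add]; exact ha _ _ ha' hb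

theorem comulLin_L (i j : Idx n) : comulLin n (L i j) =
    ∑ k, sgn ((par i + par k) * (par k + par j)) • (L i k ⊗ₜ[K] L k j) := by
  change (GradedTensorProduct.of K (gradU n) (gradU n)).symm (comulU n (L i j)) = _
  rw [comulU_L, coprL, map_sum]
  rfl

theorem comulLin_one : comulLin n 1 = 1 ⊗ₜ 1 := by
  change (GradedTensorProduct.of K (gradU n) (gradU n)).symm (comulU n 1) = _
  rw [map_one]
  rfl

theorem comulLin_parU (x : U n) :
    comulLin n (parUL n x) = TensorProduct.map (parUL n) (parUL n) (comulLin n x) := by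
  change (GradedTensorProduct.of K (gradU n) (gradU n)).symm (comulU n (parU n x)) = _
  rw [comulU_parU]
  rfl

/-- Carries the product of `GradedTensorProduct` over to the plain tensor product, where `lTensor`,
`rTensor` and the associator are available. -/
theorem of_symm_mul (z w : UU n) :
    (GradedTensorProduct.of K (gradU n) (gradU n)).symm (z * w) =
      superMul (parUL n) (parUL n) (LinearMap.mul K (U n)) (LinearMap.mul K (U n))
        ((GradedTensorProduct.of K (gradU n) (gradU n)).symm z)
        ((GradedTensorProduct.of K (gradU n) (gradU n)).symm w) := by
  induction z using UU_induction with
  | ha u v hu hv => simp only [add_mul, map_add, LinearMap.add_apply, hu, hv]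
  | h p r x hx y hy =>
    induction w using UU_induction with
    | ha u v hu hv => simp only [mul_add, map_add, hu, hv]
    | h p' r' x' hx' y' hy' =>
      rw [tm_mul_tm _ _ hy hx', map_smul]
      exact (superMul_tmul (mul := LinearMap.mul K (U n)) (mul' := LinearMap.mul K (U n)) x y' hy hx').symm

theorem comulLin_mul (x y : U n) : comulLin n (x * y) =
    superMul (parUL n) (parUL n) (LinearMap.mul K (U n)) (LinearMap.mul K (U n))
      (comulLin n x) (comulLin n y) := by
  change (GradedTensorProduct.of K (gradU n) (gradU n)).symm (comulU n (x * y)) = _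
  rw [map_mul, of_symm_mul]
  rfl

/-- If α, β, γ are the parities of L_{im}, L_{mk}, L_{kj}, both exponents equal αβ + αγ + βγ. -/
theorem coassoc_sign (i m k j : ZMod 2) :
    sgn ((i + k) * (k + j)) * sgn ((i + m) * (m + k)) =
      sgn ((i + m) * (m + j)) * sgn ((m + k) * (k + j)) := by
  simp only [← sgn_add]
  congr 1
  revert i m k j; decide

/-- Both sides are multiplicative in x for the signed product of the tensor cube, so the identity
only has to be compared on 1 and on the generators. -/
theorem comulLin_coassoc (x : U n) :
    TensorProduct.assoc K (U n) (U n) (U n) ((comulLin n).rTensor (U n) (comulLin n x)) =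
      (comulLin n).lTensor (U n) (comulLin n x) := by
  induction x using U.induction with
  | h1 =>
    rw [comulLin_one, LinearMap.rTensor_tmul, LinearMap.lTensor_tmul, comulLin_one,
      TensorProduct.assoc_tmul]
  | hL i j =>
    simp only [comulLin_L, map_sum, map_smul, LinearMap.rTensor_tmul, LinearMap.lTensor_tmul,
      TensorProduct.sum_tmul, TensorProduct.tmul_sum, ← TensorProduct.smul_tmul',
      TensorProduct.tmul_smul, TensorProduct.assoc_tmul, Finset.smul_sum, smul_smul]
    rw [Finset.sum_comm]
    refine Finset.sum_congr rfl fun m _ => Finset.sum_congr rfl fun k _ => ?_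
    rw [coassoc_sign]
  | hs c x hx => simp only [map_smul, hx]
  | ha x y hx hy => simp only [map_add, hx, hy]
  | hm x y hx hy =>
    rw [comulLin_mul, lTensor_superMul parUL_parUL comulLin_parU comulLin_mul,
      assoc_rTensor_superMul parUL_parUL comulLin_parU comulLin_mul, hx, hy]

theorem counitU_of_mem_odd {x : U n} (hx : x ∈ gradU n 1) : counitU n x = 0 := by
  have h := counitU_parU x
  rw [mem_gradU.1 hx, map_smul, sgn_one, smul_eq_mul] at h
  have h2 : (2 : K) * counitU n x = 0 := by linear_combination -h
  exact (mul_eq_zero.1 h2).resolve_left K_two_ne_zero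

/-- The counit vanishes on odd elements, so a sign carried by the parity of its argument is
invisible. -/
theorem counitU_mul_sgn {p : ZMod 2} (r : ZMod 2) {x : U n} (hx : x ∈ gradU n p) :
    sgn (p * r) * counitU n x = counitU n x := by
  rcases zmod2_cases p with rfl | rfl
  · rw [zero_mul, sgn_zero, one_mul]
  · rw [counitU_of_mem_odd hx, mul_zero]

/-- The sign of the product involves the parity of x', on which ε is evaluated; it disappears, and ε
⊗ 1 is multiplicative. -/
theorem counit_left_superMul (z w : U n ⊗[K] U n) :
    TensorProduct.lid K (U n) ((counitU n).toLinearMap.rTensor (U n)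
      (superMul (parUL n) (parUL n) (LinearMap.mul K (U n)) (LinearMap.mul K (U n)) z w)) =
    TensorProduct.lid K (U n) ((counitU n).toLinearMap.rTensor (U n) z) *
      TensorProduct.lid K (U n) ((counitU n).toLinearMap.rTensor (U n) w) := by
  induction z using tensor_induction_parity parUL_parUL parUL_parUL with
  | ha u v hu hv => simp only [add_mul, map_add, LinearMap.add_apply, hu, hv]
  | H p r x hx y hy =>
    induction w using tensor_induction_parity parUL_parUL parUL_parUL with
    | ha u v hu hv => simp only [mul_add, map_add, hu, hv]
    | H p' r' x' hx' y' hy' =>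
      rw [superMul_tmul _ _ hy hx', map_smul, map_smul]
      simp only [LinearMap.rTensor_tmul, TensorProduct.lid_tmul, AlgHom.toLinearMap_apply,
        LinearMap.mul_apply', map_mul, smul_smul, smul_mul_smul_comm]
      have := counitU_mul_sgn r hx'
      rw [mul_comm p'] at this
      congr 1
      linear_combination counitU n x * this

theorem counit_right_superMul (z w : U n ⊗[K] U n) :
    TensorProduct.rid K (U n) ((counitU n).toLinearMap.lTensor (U n)
      (superMul (parUL n) (parUL n) (LinearMap.mul K (U n)) (LinearMap.mul K (U n)) z w)) =
    TensorProduct.rid K (U n) ((counitU n).toLinearMap.lTensor (U n) z) *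
      TensorProduct.rid K (U n) ((counitU n).toLinearMap.lTensor (U n) w) := by
  induction z using tensor_induction_parity parUL_parUL parUL_parUL with
  | ha u v hu hv => simp only [add_mul, map_add, LinearMap.add_apply, hu, hv]
  | H p r x hx y hy =>
    induction w using tensor_induction_parity parUL_parUL parUL_parUL with
    | ha u v hu hv => simp only [mul_add, map_add, hu, hv]
    | H p' r' x' hx' y' hy' =>
      rw [superMul_tmul _ _ hy hx', map_smul, map_smul]
      simp only [LinearMap.lTensor_tmul, TensorProduct.rid_tmul, AlgHom.toLinearMap_apply,
        LinearMap.mul_apply', map_mul, smul_smul, smul_mul_smul_comm]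
      have := counitU_mul_sgn p' hy
      congr 1
      linear_combination counitU n y' * this

theorem comulLin_counit_left (x : U n) :
    TensorProduct.lid K (U n) ((counitU n).toLinearMap.rTensor (U n) (comulLin n x)) = x := by
  induction x using U.induction with
  | h1 => simp [comulLin_one]
  | hL i j =>
    simp only [comulLin_L, map_sum, map_smul, LinearMap.rTensor_tmul, TensorProduct.lid_tmul,
      AlgHom.toLinearMap_apply, counitU_L]
    rw [Finset.sum_eq_single i]
    · simp [CharTwo.add_self_eq_zero]
    · intro k _ hk; simp [Ne.symm hk]
    · simp
  | hs c x hx => simp only [map_smul, hx]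
  | ha x y hx hy => simp only [map_add, hx, hy]
  | hm x y hx hy => rw [comulLin_mul, counit_left_superMul, hx, hy]

theorem comulLin_counit_right (x : U n) :
    TensorProduct.rid K (U n) ((counitU n).toLinearMap.lTensor (U n) (comulLin n x)) = x := by
  induction x using U.induction with
  | h1 => simp [comulLin_one]
  | hL i j =>
    simp only [comulLin_L, map_sum, map_smul, LinearMap.lTensor_tmul, TensorProduct.rid_tmul,
      AlgHom.toLinearMap_apply, counitU_L]
    rw [Finset.sum_eq_single j]
    · simp [CharTwo.add_self_eq_zero]
    · intro k _ hk; simp [hk]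
    · simp
  | hs c x hx => simp only [map_smul, hx]
  | ha x y hx hy => simp only [map_add, hx, hy]
  | hm x y hx hy => rw [comulLin_mul, counit_right_superMul, hx, hy]

end Coalgebra

/-! ### The bi-superalgebra structure of the finite dual -/

section FiniteDualBialgebra

variable {n : ℕ}

/-! ### Parity of functionals. -/

theorem finiteDual_ext {f g : finiteDual n} (h : ∀ x, f.1 x = g.1 x) : f = g :=
  Subtype.ext (LinearMap.ext h)

theorem parFD_apply (f : finiteDual n) (x : U n) : (parFD n f).1 x = f.1 (parU n x) := rfl

theorem parFD_parFD (f : finiteDual n) : parFD n (parFD n f) = f :=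
  finiteDual_ext fun x => by rw [parFD_apply, parFD_apply, parU_parU]

theorem mem_parityPart_parFD {f : finiteDual n} {p : ZMod 2} :
    f ∈ parityPart (parFD n) p ↔ ∀ x, f.1 (parU n x) = sgn p * f.1 x := by
  rw [mem_parityPart]
  exact ⟨fun h x => congrArg (fun g : finiteDual n => g.1 x) h, fun h => finiteDual_ext h⟩

theorem apply_eq_zero_of_parity_ne {f : finiteDual n} {p r : ZMod 2}
    (hf : f ∈ parityPart (parFD n) p) {x : U n} (hx : x ∈ gradU n r) (h : p ≠ r) :
    f.1 x = 0 := by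
  have h1 := mem_parityPart_parFD.1 hf x
  rw [mem_gradU.1 hx, map_smul, smul_eq_mul] at h1
  have h2 : (2 : K) * f.1 x = 0 := by
    rcases zmod2_cases p with rfl | rfl <;> rcases zmod2_cases r with rfl | rfl <;>
      simp only [sgn_zero, sgn_one] at h1
    · exact absurd rfl h
    · linear_combination -h1
    · linear_combination h1
    · exact absurd rfl h
  exact (mul_eq_zero.1 h2).resolve_left K_two_ne_zero

/-- The parity of an element at which a functional of parity `p` does not vanish is `p`. -/
theorem parity_eq_or_apply_eq_zero {f : finiteDual n} {p r : ZMod 2}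
    (hf : f ∈ parityPart (parFD n) p) {x : U n} (hx : x ∈ gradU n r) : p = r ∨ f.1 x = 0 :=
  or_iff_not_imp_left.2 (apply_eq_zero_of_parity_ne hf hx)

/-- An additive property of functionals may be checked on homogeneous ones. -/
theorem finiteDual_induction {C : finiteDual n → Prop} (f : finiteDual n)
    (H : ∀ p, ∀ f ∈ parityPart (parFD n) p, C f) (ha : ∀ f g, C f → C g → C (f + g)) : C f := by
  rw [← parityProj_add (parFD n) f]
  exact ha _ _ (H 0 _ (parityProj_mem _ parFD_parFD 0 f)) (H 1 _ (parityProj_mem _ parFD_parFD 1 f))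

theorem finiteDual_ext_grad {f g : finiteDual n} (h : ∀ p, ∀ x ∈ gradU n p, f.1 x = g.1 x) :
    f = g := by
  refine finiteDual_ext fun x => ?_
  rw [← parityProj_add (parUL n) x, map_add, map_add,
    h 0 _ (parityProj_mem _ parUL_parUL 0 x), h 1 _ (parityProj_mem _ parUL_parUL 1 x)]

/-- The pairing of `U_q(q_n)° ⊗ U_q(q_n)°` with `U_q(q_n) ⊗ U_q(q_n)` without signs. -/
noncomputable def pairing₀ (n : ℕ) :
    finiteDual n ⊗[K] finiteDual n →ₗ[K] Module.Dual K (U n ⊗[K] U n) :=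
  TensorProduct.dualDistrib K (U n) (U n) ∘ₗ
    TensorProduct.map (finiteDual n).subtype (finiteDual n).subtype

theorem pairing₀_tmul (f g : finiteDual n) (x y : U n) :
    pairing₀ n (f ⊗ₜ g) (x ⊗ₜ y) = f.1 x * g.1 y := rfl

theorem pairing_eq_pairing₀ (F : finiteDual n ⊗[K] finiteDual n) {p r : ZMod 2} {x y : U n}
    (hx : x ∈ gradU n p) (hy : y ∈ gradU n r) :
    pairing n F (x ⊗ₜ y) = sgn (p * r) * pairing₀ n F (x ⊗ₜ y) := by
  change pairing₀ n F (koszul (parUL n) (parUL n) (x ⊗ₜ y)) = _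
  rw [koszul_tmul _ _ hx hy, map_smul, smul_eq_mul]

/-- The signed pairing is the unsigned one followed by the transpose of the Koszul operator, so
injectivity is inherited. -/
theorem pairing₀_injective (n : ℕ) : Function.Injective (pairing₀ n) := by
  have h : ∀ F, pairing n F = (koszul (parUL n) (parUL n)).dualMap (pairing₀ n F) := fun _ => rfl
  intro F G e
  exact pairing_injective n (by rw [h, h, e])

/-- Where f and g do not both vanish, the parities of x and y are p and r. The sign thus becomes a
constant, and the identity makes sense for every z, homogeneous or not; in particular for z = Δ(x).
-/
theorem pairing_tmul_of_parity {f g : finiteDual n} {p r : ZMod 2}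
    (hf : f ∈ parityPart (parFD n) p) (hg : g ∈ parityPart (parFD n) r) (z : U n ⊗[K] U n) :
    pairing n (f ⊗ₜ g) z = sgn (p * r) * pairing₀ n (f ⊗ₜ g) z := by
  induction z using tensor_induction_parity parUL_parUL parUL_parUL with
  | ha z w hz hw => rw [map_add, map_add, hz, hw, mul_add]
  | H p' r' x hx y hy =>
    rw [pairing_eq_pairing₀ _ hx hy, pairing₀_tmul]
    rcases parity_eq_or_apply_eq_zero hf hx with rfl | h
    · rcases parity_eq_or_apply_eq_zero hg hy with rfl | h
      · rfl
      · simp [h]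
    · simp [h]

theorem mulFD_apply_of_parity {f g : finiteDual n} {p r : ZMod 2}
    (hf : f ∈ parityPart (parFD n) p) (hg : g ∈ parityPart (parFD n) r) (x : U n) :
    (mulFD n f g).1 x = sgn (p * r) * pairing₀ n (f ⊗ₜ g) (comulLin n x) := by
  rw [mulFD_apply, pairing_tmul_of_parity hf hg]

theorem pairing₀_comulFD (f : finiteDual n) {p r : ZMod 2} {x y : U n}
    (hx : x ∈ gradU n p) (hy : y ∈ gradU n r) :
    pairing₀ n (comulFD n f) (x ⊗ₜ y) = sgn (p * r) * f.1 (x * y) := by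
  rw [← pairing_comulFD, pairing_eq_pairing₀ _ hx hy, ← mul_assoc, sgn_mul_self, one_mul]

/-! ### Compatibility of the structure maps with parity. -/

theorem pairing_map_par (F : finiteDual n ⊗[K] finiteDual n) (z : U n ⊗[K] U n) :
    pairing n (TensorProduct.map (parFD n) (parFD n) F) z =
      pairing n F (TensorProduct.map (parUL n) (parUL n) z) := by
  induction F with
  | zero => simp
  | add F G hF hG => simp only [map_add, LinearMap.add_apply, hF, hG]
  | tmul f g =>
    induction z using tensor_induction_parity parUL_parUL parUL_parUL with
    | ha z w hz hw => simp only [map_add, hz, hw]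
    | H p r x hx y hy =>
      have hx' : parU n x ∈ gradU n p := by
        rw [mem_gradU.1 hx]; exact Submodule.smul_mem _ _ hx
      have hy' : parU n y ∈ gradU n r := by
        rw [mem_gradU.1 hy]; exact Submodule.smul_mem _ _ hy
      rw [TensorProduct.map_tmul, TensorProduct.map_tmul, pairing_tmul _ _ hx hy]
      exact (pairing_tmul _ _ hx' hy').symm

theorem parFD_mulFD (f g : finiteDual n) :
    parFD n (mulFD n f g) = mulFD n (parFD n f) (parFD n g) := by
  refine finiteDual_ext fun x => ?_
  rw [parFD_apply, mulFD_apply, mulFD_apply, ← TensorProduct.map_tmul, pairing_map_par,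
    ← comulLin_parU]
  rfl

theorem mulFD_mem_parityPart {f g : finiteDual n} {p r : ZMod 2}
    (hf : f ∈ parityPart (parFD n) p) (hg : g ∈ parityPart (parFD n) r) :
    mulFD n f g ∈ parityPart (parFD n) (p + r) := by
  rw [mem_parityPart] at *
  rw [parFD_mulFD, hf, hg, map_smul, map_smul, LinearMap.smul_apply, smul_smul, mul_comm, sgn_add]

theorem parFD_oneFD : parFD n (oneFD n) = oneFD n :=
  finiteDual_ext fun x => counitU_parU x

theorem oneFD_mem_parityPart : oneFD n ∈ parityPart (parFD n) 0 := by
  rw [mem_parityPart, parFD_oneFD, sgn_zero, one_smul]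

theorem oneFD_apply (x : U n) : (oneFD n).1 x = counitU n x := rfl

theorem comulFD_parFD (f : finiteDual n) :
    comulFD n (parFD n f) = TensorProduct.map (parFD n) (parFD n) (comulFD n f) := by
  apply pairing_injective
  refine TensorProduct.ext' fun x y => ?_
  rw [pairing_map_par, TensorProduct.map_tmul, pairing_comulFD, pairing_comulFD, parFD_apply,
    map_mul]
  rfl

theorem counitFD_parFD (f : finiteDual n) : counitFD n (parFD n f) = counitFD n f := by
  rw [counitFD_apply, counitFD_apply, parFD_apply, map_one]

/-- The pairing of the tensor cubes of `U_q(q_n)°` and `U_q(q_n)` without signs. -/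
noncomputable def triplePairing (n : ℕ) : finiteDual n ⊗[K] (finiteDual n ⊗[K] finiteDual n) →ₗ[K]
    Module.Dual K (U n ⊗[K] (U n ⊗[K] U n)) :=
  TensorProduct.dualDistrib K (U n) (U n ⊗[K] U n) ∘ₗ
    TensorProduct.map (finiteDual n).subtype (pairing₀ n)

theorem triplePairing_tmul (f : finiteDual n) (F : finiteDual n ⊗[K] finiteDual n) (x : U n)
    (z : U n ⊗[K] U n) : triplePairing n (f ⊗ₜ F) (x ⊗ₜ z) = f.1 x * pairing₀ n F z := rfl

/-- Over a field the tensor product of two injective maps is injective, and so is the canonical map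
from a tensor product of duals to the dual of the tensor product. -/
theorem triplePairing_injective (n : ℕ) : Function.Injective (triplePairing n) := by
  have : Module.Free K (finiteDual n) := Module.Free.of_divisionRing K (finiteDual n)
  have : Module.Free K (finiteDual n ⊗[K] finiteDual n) := Module.Free.tensor
  have : Module.Free K (Module.Dual K (U n)) := Module.Free.of_divisionRing K _
  have : Module.Free K (Module.Dual K (U n ⊗[K] U n)) := Module.Free.of_divisionRing K _
  exact (dualDistrib_injective _ _).comp (TensorProduct.map_injective_of_flat_flat _ _
    (Submodule.subtype_injective _) (pairing₀_injective n))

theorem triplePairing_assoc_left (F : finiteDual n ⊗[K] finiteDual n) (h : finiteDual n)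
    (x y w : U n) :
    triplePairing n (TensorProduct.assoc K _ _ _ (F ⊗ₜ h)) (x ⊗ₜ (y ⊗ₜ w)) =
      pairing₀ n F (x ⊗ₜ y) * h.1 w := by
  induction F with
  | zero => simp
  | add F G hF hG =>
    simp only [TensorProduct.add_tmul, map_add, LinearMap.add_apply, hF, hG, add_mul]
  | tmul f g =>
    rw [TensorProduct.assoc_tmul, triplePairing_tmul, pairing₀_tmul, pairing₀_tmul, mul_assoc]

theorem triplePairing_assoc_right (f g h : finiteDual n) (z : U n ⊗[K] U n) (w : U n) :
    triplePairing n (f ⊗ₜ (g ⊗ₜ h)) (TensorProduct.assoc K _ _ _ (z ⊗ₜ w)) =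
      pairing₀ n (f ⊗ₜ g) z * h.1 w := by
  induction z with
  | zero => simp
  | add z y hz hy => simp only [TensorProduct.add_tmul, map_add, hz, hy, add_mul]
  | tmul x y =>
    rw [TensorProduct.assoc_tmul, triplePairing_tmul, pairing₀_tmul, pairing₀_tmul, mul_assoc]

/-! ### The algebra axioms of the finite dual. -/

theorem pairing₀_mulFD_left {f g : finiteDual n} {p r : ZMod 2}
    (hf : f ∈ parityPart (parFD n) p) (hg : g ∈ parityPart (parFD n) r) (h : finiteDual n)
    (z : U n ⊗[K] U n) : pairing₀ n (mulFD n f g ⊗ₜ h) z =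
      sgn (p * r) * triplePairing n (f ⊗ₜ (g ⊗ₜ h))
        (TensorProduct.assoc K _ _ _ ((comulLin n).rTensor _ z)) := by
  induction z with
  | zero => simp
  | add z y hz hy => simp only [map_add, hz, hy, mul_add]
  | tmul x y =>
    rw [LinearMap.rTensor_tmul, triplePairing_assoc_right, pairing₀_tmul,
      mulFD_apply_of_parity hf hg, mul_assoc]

theorem pairing₀_mulFD_right {f g : finiteDual n} {p r : ZMod 2}
    (hf : f ∈ parityPart (parFD n) p) (hg : g ∈ parityPart (parFD n) r) (h : finiteDual n)
    (z : U n ⊗[K] U n) : pairing₀ n (h ⊗ₜ mulFD n f g) z =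
      sgn (p * r) * triplePairing n (h ⊗ₜ (f ⊗ₜ g)) ((comulLin n).lTensor _ z) := by
  induction z with
  | zero => simp
  | add z y hz hy => simp only [map_add, hz, hy, mul_add]
  | tmul x y =>
    rw [LinearMap.lTensor_tmul, triplePairing_tmul, pairing₀_tmul, mulFD_apply_of_parity hf hg,
      mul_left_comm]

/-- For f, g, h of parities p, r, s, both products are (-1)^{pr+ps+rs} times f ⊗ g ⊗ h evaluated on
the iterated coproduct of x. -/
theorem mulFD_assoc (f g h : finiteDual n) :
    mulFD n (mulFD n f g) h = mulFD n f (mulFD n g h) := by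
  induction f using finiteDual_induction with
  | ha f f' hf hf' => simp only [map_add, LinearMap.add_apply, hf, hf']
  | H p f hf =>
  induction g using finiteDual_induction with
  | ha f f' hf hf' => simp only [map_add, LinearMap.add_apply, hf, hf']
  | H r g hg =>
  induction h using finiteDual_induction with
  | ha f f' hf hf' => simp only [map_add, hf, hf']
  | H s h hh =>
  refine finiteDual_ext fun x => ?_
  rw [mulFD_apply_of_parity (mulFD_mem_parityPart hf hg) hh, pairing₀_mulFD_left hf hg,
    mulFD_apply_of_parity hf (mulFD_mem_parityPart hg hh), pairing₀_mulFD_right hg hh,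
    comulLin_coassoc, ← mul_assoc, ← mul_assoc, ← sgn_add, ← sgn_add]
  congr 2
  ring

theorem oneFD_mulFD (f : finiteDual n) : mulFD n (oneFD n) f = f := by
  induction f using finiteDual_induction with
  | ha f g hf hg => simp only [map_add, hf, hg]
  | H p f hf =>
    refine finiteDual_ext fun x => ?_
    rw [mulFD_apply_of_parity oneFD_mem_parityPart hf, zero_mul, sgn_zero, one_mul]
    -- Once x on the right is written as (ε ⊗ 1)Δ(x), both sides are linear in Δ(x), which may be
    -- replaced by an arbitrary tensor.
    conv_rhs => rw [← comulLin_counit_left x]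
    generalize comulLin n x = z
    induction z with
    | zero => simp
    | add z y hz hy => simp only [map_add, hz, hy]
    | tmul x y =>
      rw [LinearMap.rTensor_tmul, TensorProduct.lid_tmul, map_smul]
      rfl

theorem mulFD_oneFD (f : finiteDual n) : mulFD n f (oneFD n) = f := by
  induction f using finiteDual_induction with
  | ha f g hf hg => simp only [map_add, LinearMap.add_apply, hf, hg]
  | H p f hf =>
    refine finiteDual_ext fun x => ?_
    rw [mulFD_apply_of_parity hf oneFD_mem_parityPart, mul_zero, sgn_zero, one_mul]
    conv_rhs => rw [← comulLin_counit_right x]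
    generalize comulLin n x = z
    induction z with
    | zero => simp
    | add z y hz hy => simp only [map_add, hz, hy]
    | tmul x y =>
      rw [LinearMap.lTensor_tmul, TensorProduct.rid_tmul, map_smul, pairing₀_tmul, mul_comm]
      rfl

/-! ### The coalgebra axioms of the finite dual. -/

theorem triplePairing_comul_left (F : finiteDual n ⊗[K] finiteDual n) {p r : ZMod 2} {x y : U n}
    (hx : x ∈ gradU n p) (hy : y ∈ gradU n r) (w : U n) :
    triplePairing n (TensorProduct.assoc K _ _ _ ((comulFD n).rTensor _ F)) (x ⊗ₜ (y ⊗ₜ w)) =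
      sgn (p * r) * pairing₀ n F ((x * y) ⊗ₜ w) := by
  induction F with
  | zero => simp
  | add F G hF hG => simp only [map_add, LinearMap.add_apply, hF, hG, mul_add]
  | tmul f g =>
    rw [LinearMap.rTensor_tmul, triplePairing_assoc_left, pairing₀_comulFD f hx hy, pairing₀_tmul,
      mul_assoc]

theorem triplePairing_comul_right (F : finiteDual n ⊗[K] finiteDual n) {p r : ZMod 2} {y w : U n}
    (hy : y ∈ gradU n p) (hw : w ∈ gradU n r) (x : U n) :
    triplePairing n ((comulFD n).lTensor _ F) (x ⊗ₜ (y ⊗ₜ w)) =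
      sgn (p * r) * pairing₀ n F (x ⊗ₜ (y * w)) := by
  induction F with
  | zero => simp
  | add F G hF hG => simp only [map_add, LinearMap.add_apply, hF, hG, mul_add]
  | tmul f g =>
    rw [LinearMap.lTensor_tmul, triplePairing_tmul, pairing₀_comulFD g hy hw, pairing₀_tmul,
      mul_left_comm]

/-- On x ⊗ y ⊗ w of parities p, r, s, both sides give (-1)^{pr+ps+rs} f(xyw). -/
theorem comulFD_coassoc (f : finiteDual n) :
    TensorProduct.assoc K _ _ _ ((comulFD n).rTensor _ (comulFD n f)) =
      (comulFD n).lTensor _ (comulFD n f) := by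
  apply triplePairing_injective
  refine LinearMap.ext fun z => ?_
  induction z using tensor_induction_parity parUL_parUL
    (map_map_self (parUL_parUL (n := n)) (parUL_parUL (n := n))) with
  | ha z w hz hw => simp only [map_add, hz, hw]
  | H p s x hx z hz =>
    -- The inner tensor is split again into homogeneous factors, whose individual parities replace
    -- its total parity.
    clear hz s
    induction z using tensor_induction_parity parUL_parUL parUL_parUL with
    | ha z w hz hw => simp only [TensorProduct.tmul_add, map_add, hz, hw]
    | H r s y hy w hw =>
      rw [triplePairing_comul_left _ hx hy, triplePairing_comul_right _ hy hw,
        pairing₀_comulFD _ (SetLike.mul_mem_graded hx hy) hw,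
        pairing₀_comulFD _ hx (SetLike.mul_mem_graded hy hw), mul_assoc x y w]
      have e : sgn (p * r) * sgn ((p + r) * s) = sgn (r * s) * sgn (p * (r + s)) := by
        rw [← sgn_add, ← sgn_add]
        congr 1
        ring
      linear_combination f.1 (x * (y * w)) * e

theorem counitFD_left (f : finiteDual n) :
    TensorProduct.lid K _ ((counitFD n).rTensor _ (comulFD n f)) = f := by
  -- Applying the counit to the first leg is evaluation of that leg at 1. As 1 is even, no sign
  -- arises when this is applied to the coproduct of f.
  have key : ∀ (F : finiteDual n ⊗[K] finiteDual n) (x : U n),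
      (TensorProduct.lid K _ ((counitFD n).rTensor _ F)).1 x = pairing₀ n F (1 ⊗ₜ x) := by
    intro F x
    induction F with
    | zero => simp
    | add F G hF hG =>
      simp only [map_add, LinearMap.add_apply, ← hF, ← hG]
      rfl
    | tmul f g =>
      rw [LinearMap.rTensor_tmul, TensorProduct.lid_tmul, pairing₀_tmul]
      rfl
  refine finiteDual_ext_grad fun p x hx => ?_
  rw [key, pairing₀_comulFD f (SetLike.one_mem_graded _) hx, one_mul, zero_mul, sgn_zero, one_mul]

theorem counitFD_right (f : finiteDual n) :
    TensorProduct.rid K _ ((counitFD n).lTensor _ (comulFD n f)) = f := by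
  have key : ∀ (F : finiteDual n ⊗[K] finiteDual n) (x : U n),
      (TensorProduct.rid K _ ((counitFD n).lTensor _ F)).1 x = pairing₀ n F (x ⊗ₜ 1) := by
    intro F x
    induction F with
    | zero => simp
    | add F G hF hG =>
      simp only [map_add, LinearMap.add_apply, ← hF, ← hG]
      rfl
    | tmul f g =>
      rw [LinearMap.lTensor_tmul, TensorProduct.rid_tmul, pairing₀_tmul, mul_comm]
      rfl
  refine finiteDual_ext_grad fun p x hx => ?_
  rw [key, pairing₀_comulFD f hx (SetLike.one_mem_graded _), mul_one, mul_zero, sgn_zero, one_mul]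

/-! ### Compatibility of the algebra and the coalgebra structure. -/

theorem comulFD_oneFD : comulFD n (oneFD n) = oneFD n ⊗ₜ oneFD n := by
  apply pairing_injective
  refine TensorProduct.ext' fun x y => ?_
  rw [pairing_comulFD, pairing_tmul_of_parity oneFD_mem_parityPart oneFD_mem_parityPart,
    pairing₀_tmul, oneFD_apply, oneFD_apply, oneFD_apply, map_mul, zero_mul, sgn_zero, one_mul]

theorem counitFD_mulFD (f g : finiteDual n) :
    counitFD n (mulFD n f g) = counitFD n f * counitFD n g := by
  rw [counitFD_apply, mulFD_apply, comulLin_one,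
    pairing_tmul f g (SetLike.one_mem_graded (gradU n)) (SetLike.one_mem_graded (gradU n)),
    zero_mul, sgn_zero, one_mul]
  rfl

theorem counitFD_oneFD : counitFD n (oneFD n) = 1 := by
  rw [counitFD_apply, oneFD_apply, map_one]

/-- Serves as Sweedler notation with homogeneous legs: the parities are indexed along with the
terms, so that signs can be written termwise. -/
theorem exists_homogeneous_sum (F : finiteDual n ⊗[K] finiteDual n) :
    ∃ (ι : Type) (_ : Fintype ι) (p r : ι → ZMod 2) (a b : ι → finiteDual n),
      (∀ i, a i ∈ parityPart (parFD n) (p i)) ∧ (∀ i, b i ∈ parityPart (parFD n) (r i)) ∧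
      F = ∑ i, a i ⊗ₜ b i := by
  induction F using tensor_induction_parity (M := finiteDual n) (N := finiteDual n)
    (γ := parFD n) (γ' := parFD n) parFD_parFD parFD_parFD with
  | H p r f hf g hg =>
    exact ⟨Unit, inferInstance, fun _ => p, fun _ => r, fun _ => f, fun _ => g, fun _ => hf,
      fun _ => hg, by simp⟩
  | ha F G hF hG =>
    obtain ⟨ι, _, p, r, a, b, ha, hb, rfl⟩ := hF
    obtain ⟨ι', _, p', r', a', b', ha', hb', rfl⟩ := hG
    refine ⟨ι ⊕ ι', inferInstance, Sum.elim p p', Sum.elim r r', Sum.elim a a', Sum.elim b b',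
      ?_, ?_, ?_⟩
    · rintro (i | i)
      exacts [ha i, ha' i]
    · rintro (i | i)
      exacts [hb i, hb' i]
    · rw [Fintype.sum_sum_type]
      rfl

/-- Apart from the common factor (-1)^{bc}, both sides are (-1)^e, where e is the second elementary
symmetric polynomial in a, b, c, d. -/
theorem comul_mul_sign (a b c d : ZMod 2) :
    sgn (c * b) * sgn ((a + b) * (c + d)) * (sgn (a * b) * sgn (c * d)) =
      sgn (b * c) * sgn ((a + c) * (b + d)) * (sgn (a * c) * sgn (b * d)) := by
  simp only [← sgn_add]
  congr 1
  revert a b c d; decide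

/-- With Δ°(f) = ∑ a_i ⊗ b_i and Δ°(g) = ∑ c_k ⊗ d_k, multiplicativity of Δ on U turns the left side
at x ⊗ y into f ⊗ g on Δ(x)Δ(y). Splitting f and g over the products in each leg regroups this as
a_i ⊗ c_k on Δ(x) times b_i ⊗ d_k on Δ(y), which is the right side up to the comparison of signs. -/
theorem comulFD_mulFD (f g : finiteDual n) : comulFD n (mulFD n f g) =
    superMul (M := finiteDual n) (N := finiteDual n) (parFD n) (parFD n) (mulFD n) (mulFD n)
      (comulFD n f) (comulFD n g) := by
  apply pairing_injective
  refine TensorProduct.ext' fun x y => ?_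
  rw [pairing_comulFD, mulFD_apply, comulLin_mul]
  obtain ⟨ι, _, p, r, a, b, ha, hb, hF⟩ := exists_homogeneous_sum (comulFD n f)
  obtain ⟨ι', _, p', r', c, d, hc, hd, hG⟩ := exists_homogeneous_sum (comulFD n g)
  have hf : ∀ x y, f.1 (x * y) = ∑ i, sgn (p i * r i) * ((a i).1 x * (b i).1 y) := by
    intro x y
    rw [← pairing_comulFD, hF, map_sum, LinearMap.sum_apply]
    exact Finset.sum_congr rfl fun i _ => pairing_tmul_of_parity (ha i) (hb i) _
  have hg : ∀ x y, g.1 (x * y) = ∑ i, sgn (p' i * r' i) * ((c i).1 x * (d i).1 y) := by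
    intro x y
    rw [← pairing_comulFD, hG, map_sum, LinearMap.sum_apply]
    exact Finset.sum_congr rfl fun i _ => pairing_tmul_of_parity (hc i) (hd i) _
  -- Both sides are bilinear in z and w, so homogeneous pure tensors suffice, although the formula
  -- is needed for Δ(x) and Δ(y). The signs on the right are those produced by the product in U° ⊗
  -- U°.
  have key : ∀ z w, pairing n (f ⊗ₜ g) (superMul (parUL n) (parUL n) (LinearMap.mul K (U n))
      (LinearMap.mul K (U n)) z w) = ∑ i, ∑ k,
        sgn (r i * p' k) * sgn ((p i + p' k) * (r i + r' k)) * (sgn (p i * p' k) * sgn (r i * r' k)) *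
          (pairing₀ n (a i ⊗ₜ c k) z * pairing₀ n (b i ⊗ₜ d k) w) := by
    intro z w
    induction z using tensor_induction_parity parUL_parUL parUL_parUL with
    | ha u v hu hv =>
      simp only [map_add, LinearMap.add_apply, hu, hv, add_mul, mul_add, Finset.sum_add_distrib]
    | H s t x hx y hy =>
    induction w using tensor_induction_parity parUL_parUL parUL_parUL with
    | ha u v hu hv => simp only [map_add, hu, hv, mul_add, Finset.sum_add_distrib]
    | H s' t' x' hx' y' hy' =>
      rw [superMul_tmul _ _ hy hx', map_smul, LinearMap.mul_apply', LinearMap.mul_apply',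
        pairing_tmul f g (SetLike.mul_mem_graded hx hx') (SetLike.mul_mem_graded hy hy'), hf, hg,
        Finset.sum_mul_sum, smul_eq_mul, Finset.mul_sum, Finset.mul_sum]
      refine Finset.sum_congr rfl fun i _ => ?_
      rw [Finset.mul_sum, Finset.mul_sum]
      refine Finset.sum_congr rfl fun k _ => ?_
      rw [pairing₀_tmul, pairing₀_tmul]
      -- Each of the four functionals either vanishes on its argument, making both terms zero, or
      -- has the parity of its argument. In the remaining case all signs are functions of the four
      -- parities of the functionals.
      rcases parity_eq_or_apply_eq_zero (ha i) hx with e1 | h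
      swap; · simp [h]
      rcases parity_eq_or_apply_eq_zero (hc k) hy with e2 | h
      swap; · simp [h]
      rcases parity_eq_or_apply_eq_zero (hb i) hx' with e3 | h
      swap; · simp [h]
      rcases parity_eq_or_apply_eq_zero (hd k) hy' with e4 | h
      swap; · simp [h]
      rw [← e1, ← e2, ← e3, ← e4]
      linear_combination ((a i).1 x * (b i).1 x' * ((c k).1 y * (d k).1 y')) *
        comul_mul_sign (p i) (r i) (p' k) (r' k)
  rw [key, hF, hG]
  simp only [map_sum, LinearMap.sum_apply]
  rw [Finset.sum_comm]
  refine Finset.sum_congr rfl fun k _ => Finset.sum_congr rfl fun i _ => ?_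
  rw [superMul_tmul _ _ (hb i) (hc k), map_smul, LinearMap.smul_apply, smul_eq_mul,
    pairing_tmul_of_parity (mulFD_mem_parityPart (ha i) (hc k))
      (mulFD_mem_parityPart (hb i) (hd k)), pairing₀_tmul, mulFD_apply_of_parity (ha i) (hc k),
    mulFD_apply_of_parity (hb i) (hd k)]
  ring

theorem isBisuperalgebra_finiteDual (n : ℕ) :
    IsBisuperalgebra (parFD n) (mulFD n) (oneFD n) (comulFD n) (counitFD n) where
  par_par := parFD_parFD
  par_mul := parFD_mulFD
  par_one := parFD_oneFD
  par_comul := comulFD_parFD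
  par_counit := counitFD_parFD
  mul_assoc := mulFD_assoc
  one_mul := oneFD_mulFD
  mul_one := mulFD_oneFD
  coassoc := comulFD_coassoc
  counit_left := counitFD_left
  counit_right := counitFD_right
  -- `tensorMul` is `superMul` with equal factors; the two unfold to the same expression.
  comul_mul := comulFD_mulFD
  comul_one := comulFD_oneFD
  counit_mul := counitFD_mulFD
  counit_one := counitFD_oneFD

end FiniteDualBialgebra

/-! ### The matrix elements of the vector supermodule -/

section MatrixElements

variable {n : ℕ}

theorem tElt_apply_mul (a b : Idx n) (x y : U n) :
    (tElt a b).1 (x * y) = ∑ c, (tElt a c).1 x * (tElt c b).1 y := by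
  simp only [tElt_apply, map_mul, Matrix.mul_apply]

theorem tElt_apply_L (a b i j : Idx n) : (tElt a b).1 (L i j) = Smat a b i j := by
  rw [tElt_apply, vecRep_L]

theorem tElt_apply_one (a b : Idx n) : (tElt a b).1 1 = if a = b then 1 else 0 := by
  rw [tElt_apply, map_one, Matrix.one_apply]

theorem tElt_mem_parityPart (a b : Idx n) : tElt a b ∈ parityPart (parFD n) (par a + par b) :=
  mem_parityPart_parFD.2 fun x => vecRep_parU x a b

/-- Matrix coefficients multiply as matrices without sign; the stated sign is exactly the one that
cancels the Koszul sign of the pairing. -/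
theorem comulFD_tElt (a b : Idx n) : comulFD n (tElt a b) =
    ∑ c, sgn ((par a + par c) * (par c + par b)) • (tElt a c ⊗ₜ[K] tElt c b) := by
  apply pairing_injective
  refine TensorProduct.ext' fun x y => ?_
  rw [pairing_comulFD, tElt_apply_mul, map_sum, LinearMap.sum_apply]
  refine Finset.sum_congr rfl fun c _ => ?_
  rw [map_smul, LinearMap.smul_apply,
    pairing_tmul_of_parity (tElt_mem_parityPart a c) (tElt_mem_parityPart c b), smul_eq_mul,
    ← mul_assoc, sgn_mul_self, one_mul, pairing₀_tmul]

theorem idx_neg_neg (i : Idx n) : - -i = i := Subtype.ext (neg_neg i.1)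

theorem idx_neg_inj (i j : Idx n) : -i = -j ↔ i = j := by
  rw [idx_eq_neg, idx_neg_neg, eq_comm]

theorem phi_neg_left (i j : Idx n) : phi (-i) j = phi i j := by
  unfold phi
  simp only [idx_neg_inj, idx_eq_neg i j, eq_comm (a := -i) (b := j), add_comm]

/-- `S` commutes with `J ⊗ 1`, where `J` exchanges `v_i` and `v_{-i}`. -/
theorem Smat_neg_neg (a b c d : Idx n) : Smat (-a) (-b) c d = Smat a b c d := by
  unfold Smat
  -- Negating both indices exchanges E_{ji} with E_{-j,-i}, hence the two Kronecker terms, and fixes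
  -- the diagonal part because φ(-i,j) = φ(i,j).
  simp only [phi_neg_left, idx_neg_inj, idx_eq_neg a d, idx_eq_neg b c, eq_comm (a := -a) (b := d),
    eq_comm (a := -b) (b := c), add_comm (if d = -a ∧ c = -b then (1 : K) else 0)]

/-- The matrices invariant under simultaneous negation of both indices form a subalgebra, and the
generators act by such matrices. -/
theorem vecRep_neg_neg (x : U n) (a b : Idx n) : vecRep n x (-a) (-b) = vecRep n x a b := by
  induction x using U.induction generalizing a b with
  | h1 => simp only [map_one, Matrix.one_apply, idx_neg_inj]
  | hL i j => rw [vecRep_L, vecRep_L, Smat_neg_neg]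
  | hs c x hx => rw [map_smul, Matrix.smul_apply, Matrix.smul_apply, hx]
  | ha x y hx hy => rw [map_add, Matrix.add_apply, Matrix.add_apply, hx, hy]
  | hm x y hx hy =>
    rw [map_mul, Matrix.mul_apply, Matrix.mul_apply]
    -- The summation index of the matrix product is replaced by its negative.
    refine Fintype.sum_equiv ⟨fun i => -i, fun i => -i, idx_neg_neg, idx_neg_neg⟩ _ _ fun c => ?_
    rw [← hx a, ← hy _ b]
    simp only [Equiv.coe_fn_mk, idx_neg_neg]

theorem tElt_neg_neg (a b : Idx n) : tElt a b = tElt (-a) (-b) :=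
  finiteDual_ext fun x => (vecRep_neg_neg x a b).symm

end MatrixElements

/-! ### The quantum coordinate superalgebra -/

section CoordinateAlgebra

variable {n : ℕ}

/-- The square `A ⊗ A` of a sub-superalgebra `A` is closed under multiplication. -/
theorem superMul_mem_range {M : Type*} [AddCommGroup M] [Module K M] {γ : M →ₗ[K] M}
    {mul : M →ₗ[K] M →ₗ[K] M} {A : Submodule K M} (hγ : ∀ x ∈ A, γ x ∈ A)
    (hmul : ∀ x ∈ A, ∀ y ∈ A, mul x y ∈ A) {F G : M ⊗[K] M}
    (hF : F ∈ LinearMap.range (TensorProduct.map A.subtype A.subtype))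
    (hG : G ∈ LinearMap.range (TensorProduct.map A.subtype A.subtype)) :
    superMul γ γ mul mul F G ∈ LinearMap.range (TensorProduct.map A.subtype A.subtype) := by
  -- A graded subspace contains the homogeneous components of its elements, and the signed product
  -- is built from these.
  have hp : ∀ p, ∀ x ∈ A, parityProj γ p x ∈ A := fun p x hx =>
    A.smul_mem _ (A.add_mem hx (A.smul_mem _ (hγ x hx)))
  obtain ⟨F, rfl⟩ := hF
  obtain ⟨G, rfl⟩ := hG
  induction F with
  | zero => simp only [map_zero, LinearMap.zero_apply, Submodule.zero_mem]
  | add F F' hF hF' =>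
    rw [map_add, map_add, LinearMap.add_apply]; exact Submodule.add_mem _ hF hF'
  | tmul f g =>
    induction G with
    | zero => simp only [map_zero, Submodule.zero_mem]
    | add F F' hF hF' => rw [map_add, map_add]; exact Submodule.add_mem _ hF hF'
    | tmul f' g' =>
      simp only [superMul, LinearMap.sum_apply, LinearMap.smul_apply, TensorProduct.map_tmul,
        TensorProduct.map₂_apply_tmul, Submodule.subtype_apply]
      exact Submodule.sum_mem _ fun p _ => Submodule.sum_mem _ fun r _ => Submodule.smul_mem _ _
        ⟨⟨_, hmul f.1 f.2 _ (hp r f'.1 f'.2)⟩ ⊗ₜ ⟨_, hmul _ (hp p g.1 g.2) g'.1 g'.2⟩, rfl⟩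

theorem parFD_mem_coordAlg {f : finiteDual n} (hf : f ∈ coordAlg n) : parFD n f ∈ coordAlg n :=
  Submodule.mem_sInf.2 fun A hA => hA.1 f (Submodule.mem_sInf.1 hf A hA)

theorem oneFD_mem_coordAlg : oneFD n ∈ coordAlg n :=
  Submodule.mem_sInf.2 fun _ hA => hA.2.1

theorem tElt_mem_coordAlg (a b : Idx n) : tElt a b ∈ coordAlg n :=
  Submodule.mem_sInf.2 fun _ hA => hA.2.2.1 a b

theorem mulFD_mem_coordAlg {f g : finiteDual n} (hf : f ∈ coordAlg n) (hg : g ∈ coordAlg n) :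
    mulFD n f g ∈ coordAlg n :=
  Submodule.mem_sInf.2 fun A hA =>
    hA.2.2.2 f (Submodule.mem_sInf.1 hf A hA) g (Submodule.mem_sInf.1 hg A hA)

theorem tmul_mem_coordAlg {f g : finiteDual n} (hf : f ∈ coordAlg n) (hg : g ∈ coordAlg n) :
    f ⊗ₜ[K] g ∈
      LinearMap.range (TensorProduct.map (coordAlg n).subtype (coordAlg n).subtype) :=
  ⟨⟨f, hf⟩ ⊗ₜ ⟨g, hg⟩, rfl⟩

theorem map_par_mem_coordAlg {F : finiteDual n ⊗[K] finiteDual n}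
    (hF : F ∈ LinearMap.range (TensorProduct.map (coordAlg n).subtype (coordAlg n).subtype)) :
    TensorProduct.map (parFD n) (parFD n) F ∈
      LinearMap.range (TensorProduct.map (coordAlg n).subtype (coordAlg n).subtype) := by
  obtain ⟨F, rfl⟩ := hF
  induction F with
  | zero => rw [map_zero, map_zero]; exact Submodule.zero_mem _
  | add F G hF hG => rw [map_add, map_add]; exact Submodule.add_mem _ hF hG
  | tmul f g =>
    exact tmul_mem_coordAlg (parFD_mem_coordAlg f.2) (parFD_mem_coordAlg g.2)

theorem comulFD_mem_coordAlg {f : finiteDual n} (hf : f ∈ coordAlg n) : comulFD n f ∈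
    LinearMap.range (TensorProduct.map (coordAlg n).subtype (coordAlg n).subtype) := by
  -- The elements of A with coproduct in A ⊗ A satisfy all the closure conditions defining A, so
  -- minimality of A applies.
  have h : coordAlg n ≤ coordAlg n ⊓ (LinearMap.range
      (TensorProduct.map (coordAlg n).subtype (coordAlg n).subtype)).comap (comulFD n) := by
    refine sInf_le ⟨fun f hf => ⟨parFD_mem_coordAlg hf.1, ?_⟩, ⟨oneFD_mem_coordAlg, ?_⟩,
      fun a b => ⟨tElt_mem_coordAlg a b, ?_⟩, fun f hf g hg =>
        ⟨mulFD_mem_coordAlg hf.1 hg.1, ?_⟩⟩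
    · rw [SetLike.mem_coe, Submodule.mem_comap, comulFD_parFD]
      exact map_par_mem_coordAlg hf.2
    · rw [SetLike.mem_coe, Submodule.mem_comap, comulFD_oneFD]
      exact tmul_mem_coordAlg oneFD_mem_coordAlg oneFD_mem_coordAlg
    · rw [SetLike.mem_coe, Submodule.mem_comap, comulFD_tElt]
      exact Submodule.sum_mem _ fun c _ => Submodule.smul_mem _ _
        (tmul_mem_coordAlg (tElt_mem_coordAlg a c) (tElt_mem_coordAlg c b))
    · rw [SetLike.mem_coe, Submodule.mem_comap, comulFD_mulFD]
      exact superMul_mem_range (M := finiteDual n) (fun _ => parFD_mem_coordAlg)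
        (fun _ h _ => mulFD_mem_coordAlg h) hf.2 hg.2
  exact (h hf).2

theorem isSubBisuperalgebra_coordAlg (n : ℕ) :
    IsSubBisuperalgebra (parFD n) (mulFD n) (oneFD n) (comulFD n) (coordAlg n) where
  par_mem _ := parFD_mem_coordAlg
  one_mem := oneFD_mem_coordAlg
  mul_mem _ hf _ hg := mulFD_mem_coordAlg hf hg
  comul_mem _ := comulFD_mem_coordAlg

end CoordinateAlgebra

/-! ### The relation `S¹² T¹³ T²³ = T²³ T¹³ S¹²` -/

section RTT

variable {n : ℕ}

/-! ### Values of the quadratic monomials in the t_{ab}. -/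

theorem tElt_mul_apply_L (b j d l i k : Idx n) : (mulFD n (tElt b j) (tElt d l)).1 (L i k) =
    ∑ m, Smat b j i m * Smat d l m k := by
  rw [mulFD_apply, comulLin_L, map_sum]
  refine Finset.sum_congr rfl fun m _ => ?_
  -- The sign in Δ(L_{ik}) is the product of the parities of the two legs, and so is the sign of the
  -- pairing; they cancel.
  rw [map_smul, pairing_tmul _ _ (L_mem i m) (L_mem m k), smul_eq_mul, ← mul_assoc, sgn_mul_self,
    one_mul, tElt_apply_L, tElt_apply_L]

theorem tElt_mul_apply_one (b j d l : Idx n) : (mulFD n (tElt b j) (tElt d l)).1 1 =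
    (if b = j then 1 else 0) * (if d = l then 1 else 0) := by
  rw [← counitFD_apply, counitFD_mulFD, counitFD_apply, counitFD_apply, tElt_apply_one,
    tElt_apply_one]

/-- For A = b+e, B = e+j, C = d+f, D = f+l the exponent on the left is AB + CD + BC + (A+C)(B+D), in
which everything but AD cancels modulo 2. -/
theorem tElt_mul_sign (b e j d f l : ZMod 2) :
    sgn ((b + e) * (e + j)) * sgn ((d + f) * (f + l)) * (sgn ((e + j) * (d + f)) *
      sgn ((b + e + (d + f)) * (e + j + (f + l)))) = sgn ((b + e) * (f + l)) := by
  simp only [← sgn_add]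
  congr 1
  revert b e j d f l; decide

/-- Evaluation at xy is the coproduct of t_{bj} t_{dl} evaluated at x ⊗ y, and the coproduct is
multiplicative. One sign survives, which prevents the unsigned values from forming a representation.
-/
theorem tElt_mul_apply_mul (b j d l : Idx n) (x y : U n) :
    (mulFD n (tElt b j) (tElt d l)).1 (x * y) =
      ∑ e, ∑ f, sgn ((par b + par e) * (par f + par l)) *
        ((mulFD n (tElt b e) (tElt d f)).1 x * (mulFD n (tElt e j) (tElt f l)).1 y) := by
  rw [← pairing_comulFD, comulFD_mulFD, comulFD_tElt, comulFD_tElt]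
  simp only [map_sum, map_smul, LinearMap.sum_apply, LinearMap.smul_apply, Finset.smul_sum]
  rw [Finset.sum_comm]
  refine Finset.sum_congr rfl fun e _ => Finset.sum_congr rfl fun f _ => ?_
  rw [superMul_tmul _ _ (tElt_mem_parityPart e j) (tElt_mem_parityPart d f), map_smul,
    LinearMap.smul_apply, pairing_tmul_of_parity
      (mulFD_mem_parityPart (tElt_mem_parityPart b e) (tElt_mem_parityPart d f))
      (mulFD_mem_parityPart (tElt_mem_parityPart e j) (tElt_mem_parityPart f l)), pairing₀_tmul,
    ← tElt_mul_sign (par b) (par e) (par j) (par d) (par f) (par l)]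
  simp only [smul_eq_mul]
  ring

/-- The matrices of the action of `U_q(q_n)` on the tensor square of the vector supermodule, with
the signs for which they are multiplicative. -/
noncomputable def tensorSquareMat (x : U n) : Matrix (Idx n × Idx n) (Idx n × Idx n) K :=
  Matrix.of fun r s => sgn ((par r.1 + par s.1) * par s.2) *
    (mulFD n (tElt r.1 s.1) (tElt r.2 s.2)).1 x

/-- The matrix of `S` on the tensor square of the vector supermodule. -/
noncomputable def signedS : Matrix (Idx n × Idx n) (Idx n × Idx n) K :=
  Matrix.of fun r s => sgn (par s.1 * par r.2) * Smat r.1 s.1 r.2 s.2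

/-! ### The action on the tensor square and its intertwiner. -/

theorem tensorSquareMat_add (x y : U n) :
    tensorSquareMat (x + y) = tensorSquareMat x + tensorSquareMat y := by
  ext r s
  simp only [tensorSquareMat, Matrix.of_apply, Matrix.add_apply, map_add, mul_add]

theorem tensorSquareMat_smul (c : K) (x : U n) :
    tensorSquareMat (c • x) = c • tensorSquareMat x := by
  ext r s
  simp only [tensorSquareMat, Matrix.of_apply, Matrix.smul_apply, map_smul, smul_eq_mul]
  ring

theorem tensorSquareMat_one : tensorSquareMat (1 : U n) = 1 := by
  ext ⟨b, d⟩ ⟨j, l⟩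
  simp only [tensorSquareMat, Matrix.of_apply, tElt_mul_apply_one, Matrix.one_apply,
    Prod.mk.injEq]
  by_cases h : b = j
  · subst h
    simp [CharTwo.add_self_eq_zero]
  · simp [h]

theorem tensorSquareMat_sign (b e j f l : ZMod 2) :
    sgn ((b + j) * l) * sgn ((b + e) * (f + l)) = sgn ((b + e) * f) * sgn ((e + j) * l) := by
  simp only [← sgn_add]
  congr 1
  revert b e j f l; decide

/-- These matrices are those of the action on V ⊗ V conjugated by the diagonal matrix with entries
(-1)^{|b||d|}. The chosen sign absorbs the one left over in `tElt_mul_apply_mul`. -/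
theorem tensorSquareMat_mul (x y : U n) :
    tensorSquareMat (x * y) = tensorSquareMat x * tensorSquareMat y := by
  ext ⟨b, d⟩ ⟨j, l⟩
  simp only [tensorSquareMat, Matrix.of_apply, Matrix.mul_apply, tElt_mul_apply_mul,
    Fintype.sum_prod_type, Finset.mul_sum]
  refine Finset.sum_congr rfl fun e _ => Finset.sum_congr rfl fun f _ => ?_
  linear_combination ((mulFD n (tElt b e) (tElt d f)).1 x * (mulFD n (tElt e j) (tElt f l)).1 y) *
    tensorSquareMat_sign (par b) (par e) (par j) (par f) (par l)

theorem signedS_sign_left (b c d i m j l : ZMod 2) (h : b + j + (i + m) = 0) :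
    sgn (b * c) * sgn ((b + j) * l) =
      sgn (j * c) * (sgn ((c + d) * (i + m)) * sgn ((i + m) * (d + l))) := by
  simp only [← sgn_add]
  congr 1
  revert b c d i m j l; decide

theorem signedS_sign_right (b c d i m j l : ZMod 2) (h : c + d + (i + m) = 0)
    (h' : b + j + (d + l) = 0) :
    sgn ((c + d) * b) * sgn (j * d) = sgn (j * c) * sgn ((i + m) * (d + l)) := by
  simp only [← sgn_add]
  congr 1
  revert b c d i m j l; decide

/-- This is the Yang–Baxter equation S¹² S¹³ S²³ = S²³ S¹³ S¹² at E_{aj} ⊗ E_{cl} ⊗ E_{ik}: the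
coproduct of L_{ik} supplies the factors S¹³ and S²³, and `signedS` supplies S¹². -/
theorem signedS_mul_tensorSquareMat_L (i k : Idx n) :
    signedS * tensorSquareMat (L i k) =
      (tensorSquareMat (L i k)).submatrix Prod.swap Prod.swap * signedS := by
  ext ⟨a, c⟩ ⟨j, l⟩
  -- The factor (-1)^{|j||c|} is the discrepancy between the signs of the matrix products and those
  -- of the Koszul product. It does not involve the summation indices.
  have h := congrArg (fun z => sgn (par j * par c) * z)
    (congrFun (congrFun (matL_rll c l i k) a) j)
  simp only [matL_relLeft, matL_relRight, Matrix.mul_apply, Finset.mul_sum] at h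
  simp only [Matrix.mul_apply, Matrix.submatrix_apply, signedS, tensorSquareMat, Matrix.of_apply,
    Fintype.sum_prod_type, Prod.swap, tElt_mul_apply_L, Finset.mul_sum, Finset.sum_mul]
  have cyc : ∀ F : Idx n → Idx n → Idx n → K,
      ∑ b, ∑ d, ∑ m, F b d m = ∑ d, ∑ m, ∑ b, F b d m := fun F => by
    rw [Finset.sum_comm]
    exact Finset.sum_congr rfl fun d _ => Finset.sum_comm
  refine (cyc _).trans (Eq.trans ?_ (h.trans (Eq.trans ?_ (cyc _).symm)))
  · refine Finset.sum_congr rfl fun d _ => Finset.sum_congr rfl fun m _ =>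
      Finset.sum_congr rfl fun b _ => ?_
    simp only [matL, Matrix.of_apply]
    -- The signs agree only where the parities are balanced; the other terms vanish since S is even.
    by_cases h0 : par b + par j + (par i + par m) = 0
    · linear_combination (Smat a b c d * Smat b j i m * Smat d l m k) *
        signedS_sign_left _ (par c) (par d) _ _ _ (par l) h0
    · rw [Smat_even _ _ _ _ h0]; ring
  · refine Finset.sum_congr rfl fun d _ => Finset.sum_congr rfl fun m _ =>
      Finset.sum_congr rfl fun b _ => ?_
    simp only [matL, Matrix.of_apply]
    by_cases h0 : par c + par d + (par i + par m) = 0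
    · by_cases h1 : par b + par j + (par d + par l) = 0
      · linear_combination -(Smat c d i m * Smat a b m k * Smat b j d l) *
          signedS_sign_right _ _ _ _ _ _ _ h0 h1
      · rw [Smat_even _ _ _ _ h1]; ring
    · rw [Smat_even _ _ _ _ h0]; ring

/-- After undoing the diagonal conjugation, this says that the graded flip composed with S is
U-linear on V ⊗ V. The condition passes to sums, scalar multiples and products of elements, so the
generators decide. -/
theorem signedS_mul_tensorSquareMat (x : U n) :
    signedS * tensorSquareMat x =
      (tensorSquareMat x).submatrix Prod.swap Prod.swap * signedS := by
  induction x using U.induction with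
  | h1 =>
    rw [tensorSquareMat_one, Matrix.submatrix_one _ Prod.swap_injective, mul_one, one_mul]
  | hL i k => exact signedS_mul_tensorSquareMat_L i k
  | hs c x hx =>
    rw [tensorSquareMat_smul, Matrix.mul_smul, hx, Matrix.submatrix_smul, Pi.smul_apply,
      Pi.smul_apply, Matrix.smul_mul]
  | ha x y hx hy =>
    rw [tensorSquareMat_add, Matrix.mul_add, hx, hy, Matrix.submatrix_add, Pi.add_apply,
      Pi.add_apply, Matrix.add_mul]
  | hm x y hx hy =>
    rw [tensorSquareMat_mul, ← Matrix.mul_assoc, hx, Matrix.mul_assoc, hy, ← Matrix.mul_assoc,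
      Matrix.submatrix_mul _ _ Prod.swap Prod.swap Prod.swap Prod.swap_bijective]

theorem rtt_sign_left (b c j l : ZMod 2) :
    sgn ((b + j) * (c + l)) = sgn (j * c) * (sgn (b * c) * sgn ((b + j) * l)) := by
  simp only [← sgn_add]
  congr 1
  revert b c j l; decide

theorem rtt_sign_right (b c d j : ZMod 2) :
    sgn ((c + d) * (b + j)) = sgn (j * c) * (sgn ((c + d) * b) * sgn (j * d)) := by
  simp only [← sgn_add]
  congr 1
  revert b c d j; decide

/-- The relation `S¹² T¹³ T²³ = T²³ T¹³ S¹²` in coefficients. -/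
theorem rtt_coeff (a j c l : Idx n) :
    ∑ b, ∑ d, (sgn ((par b + par j) * (par c + par l)) * Smat a b c d) •
      mulFD n (tElt b j) (tElt d l) =
    ∑ b, ∑ d, (sgn ((par c + par d) * (par b + par j)) * Smat b j d l) •
      mulFD n (tElt c d) (tElt a b) := by
  refine finiteDual_ext fun x => ?_
  -- At a fixed x the relation is one entry of the intertwining identity, up to the same sign
  -- (-1)^{|j||c|}. The swap of both index pairs is what reverses the order of the t's on the right.
  have h := congrArg (fun z => sgn (par j * par c) * z)
    (congrFun (congrFun (signedS_mul_tensorSquareMat x) (a, c)) (j, l))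
  simp only [Matrix.mul_apply, Matrix.submatrix_apply, signedS, tensorSquareMat, Matrix.of_apply,
    Fintype.sum_prod_type, Prod.swap, Finset.mul_sum] at h
  simp only [Submodule.coe_sum, Submodule.coe_smul, LinearMap.sum_apply, LinearMap.smul_apply,
    smul_eq_mul]
  refine Eq.trans ?_ (h.trans ?_)
  · refine Finset.sum_congr rfl fun b _ => Finset.sum_congr rfl fun d _ => ?_
    rw [rtt_sign_left]
    ring
  · refine Finset.sum_congr rfl fun b _ => Finset.sum_congr rfl fun d _ => ?_
    rw [rtt_sign_right]
    ring

/-! ### Expansion of the triple products in End V ⊗ End V ⊗ U°. -/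

theorem mulEE_S12_T13 (a b c d : Idx n) :
    mulEE (M := finiteDual n) (parFD n) (mulFD n) (S12 n) (T13 n) a b c d =
      ∑ e, (sgn ((par c + par d) * (par e + par b)) * Smat a e c d) • tElt e b := by
  simp only [mulEE]
  refine Finset.sum_congr rfl fun e _ => ?_
  rw [Finset.sum_eq_single d, Finset.sum_eq_single 0]
  · rw [S12, T13, if_pos rfl, map_smul, parityProj_of_mem _ oneFD_mem_parityPart, if_pos rfl,
      map_smul, LinearMap.smul_apply, oneFD_mulFD, smul_smul, zero_mul, sgn_zero, mul_one]
  · intro p _ hp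
    rw [S12, map_smul, parityProj_of_mem _ oneFD_mem_parityPart, if_neg hp, smul_zero, map_zero,
      LinearMap.zero_apply, smul_zero]
  · simp
  · intro f _ hf
    simp only [T13, if_neg hf, map_zero, smul_zero, Finset.sum_const_zero]
  · simp

/-- Both E_{cd} and t_{cd} pass E_{ab}, and they have the same parity, so the two signs cancel. -/
theorem mulEE_T23_T13 (a b c d : Idx n) :
    mulEE (M := finiteDual n) (parFD n) (mulFD n) (T23 n) (T13 n) a b c d =
      mulFD n (tElt c d) (tElt a b) := by
  simp only [mulEE]
  rw [Finset.sum_eq_single a, Finset.sum_eq_single d, Finset.sum_eq_single (par c + par d)]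
  · rw [T23, T13, if_pos rfl, if_pos rfl, parityProj_of_mem _ (tElt_mem_parityPart c d), if_pos rfl,
      CharTwo.add_self_eq_zero (par d), add_zero, sgn_mul_self, one_smul]
  · intro p _ hp
    rw [T23, if_pos rfl, parityProj_of_mem _ (tElt_mem_parityPart c d), if_neg hp, map_zero,
      LinearMap.zero_apply, smul_zero]
  · simp
  · intro f _ hf
    simp only [T13, if_neg hf, map_zero, smul_zero, Finset.sum_const_zero]
  · simp
  · intro e _ he
    simp only [T23, if_neg (Ne.symm he), map_zero, LinearMap.zero_apply, smul_zero,
      Finset.sum_const_zero]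
  · simp

theorem rtt_left (a j c l : Idx n) :
    mulEE (M := finiteDual n) (parFD n) (mulFD n)
      (mulEE (M := finiteDual n) (parFD n) (mulFD n) (S12 n) (T13 n)) (T23 n) a j c l =
    ∑ b, ∑ d, (sgn ((par b + par j) * (par c + par l)) * Smat a b c d) •
      mulFD n (tElt b j) (tElt d l) := by
  rw [mulEE, Finset.sum_eq_single j]
  · refine Eq.trans ?_ Finset.sum_comm
    refine Finset.sum_congr rfl fun d _ => ?_
    simp only [mulEE_S12_T13, T23, if_true, map_sum, map_smul, LinearMap.sum_apply,
      LinearMap.smul_apply, Finset.smul_sum]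
    rw [Finset.sum_comm]
    refine Finset.sum_congr rfl fun b _ => ?_
    rw [Finset.sum_eq_single (par b + par j)]
    · rw [parityProj_of_mem _ (tElt_mem_parityPart b j), if_pos rfl, smul_smul]
      congr 1
      -- Passing E_{bj} by E_{cd} and E_{dl} by t_{bj} gives (b+j)(c+d) + (b+j)(d+l) = (b+j)(c+l)
      -- modulo 2, with indices standing for their parities.
      have e : sgn ((par b + par j) * (par c + par l)) =
          sgn ((par c + par d) * (par j + par j)) *
            sgn ((par b + par j) * (par j + par j + (par d + par l))) *
              sgn ((par c + par d) * (par b + par j)) := by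
        simp only [← sgn_add]
        congr 1
        generalize par b = b, par j = j, par c = c, par l = l, par d = d
        revert b j c l d; decide
      rw [e]
      ring
    · intro p _ hp
      rw [parityProj_of_mem _ (tElt_mem_parityPart b j), if_neg hp, map_zero,
        LinearMap.zero_apply, smul_zero, smul_zero]
    · simp
  · intro b _ hb
    simp only [T23, if_neg hb, map_zero, smul_zero, Finset.sum_const_zero]
  · simp

theorem rtt_right (a j c l : Idx n) :
    mulEE (M := finiteDual n) (parFD n) (mulFD n)
      (mulEE (M := finiteDual n) (parFD n) (mulFD n) (T23 n) (T13 n)) (S12 n) a j c l =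
    ∑ b, ∑ d, (sgn ((par c + par d) * (par b + par j)) * Smat b j d l) •
      mulFD n (tElt c d) (tElt a b) := by
  rw [mulEE]
  refine Finset.sum_congr rfl fun b _ => Finset.sum_congr rfl fun d _ => ?_
  by_cases h0 : par b + par j + (par d + par l) = 0
  · simp only [mulEE_T23_T13, S12, h0, mul_zero, sgn_zero, mul_one, map_smul, mulFD_oneFD]
    -- For an even coefficient of S no sign depends on the parity of the functional, so its two
    -- homogeneous parts recombine.
    rw [sum_zmod2, ← smul_add, ← smul_add, parityProj_add, smul_smul]
  · simp only [S12, Smat_even _ _ _ _ h0, zero_smul, map_zero, smul_zero, mul_zero,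
      Finset.sum_const_zero]

theorem rtt (n : ℕ) :
    mulEE (M := finiteDual n) (parFD n) (mulFD n)
      (mulEE (M := finiteDual n) (parFD n) (mulFD n) (S12 n) (T13 n)) (T23 n) =
    mulEE (M := finiteDual n) (parFD n) (mulFD n)
      (mulEE (M := finiteDual n) (parFD n) (mulFD n) (T23 n) (T13 n)) (S12 n) := by
  funext a j c l
  rw [rtt_left, rtt_right, rtt_coeff]

end RTT

end QueerSuper

theorem mainTheorem8 (n : ℕ) :
    QueerSuper.IsBisuperalgebra (QueerSuper.parFD n) (QueerSuper.mulFD n) (QueerSuper.oneFD n)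
      (QueerSuper.comulFD n) (QueerSuper.counitFD n) ∧
    QueerSuper.IsSubBisuperalgebra (QueerSuper.parFD n) (QueerSuper.mulFD n) (QueerSuper.oneFD n)
      (QueerSuper.comulFD n) (QueerSuper.coordAlg n) ∧
    (∀ a b : QueerSuper.Idx n, QueerSuper.tElt a b ∈ QueerSuper.coordAlg n ∧
      QueerSuper.tElt a b ∈
        QueerSuper.parityPart (QueerSuper.parFD n) (QueerSuper.par a + QueerSuper.par b)) ∧
    (∀ a b : QueerSuper.Idx n, QueerSuper.tElt a b = QueerSuper.tElt (-a) (-b)) ∧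
    (QueerSuper.mulEE (QueerSuper.parFD n) (QueerSuper.mulFD n)
        (QueerSuper.mulEE (QueerSuper.parFD n) (QueerSuper.mulFD n)
          (QueerSuper.S12 n) (QueerSuper.T13 n)) (QueerSuper.T23 n) =
      QueerSuper.mulEE (QueerSuper.parFD n) (QueerSuper.mulFD n)
        (QueerSuper.mulEE (QueerSuper.parFD n) (QueerSuper.mulFD n)
          (QueerSuper.T23 n) (QueerSuper.T13 n)) (QueerSuper.S12 n)) ∧
    (∀ a b : QueerSuper.Idx n, QueerSuper.comulFD n (QueerSuper.tElt a b) =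
      ∑ c, QueerSuper.sgn ((QueerSuper.par a + QueerSuper.par c) *
          (QueerSuper.par c + QueerSuper.par b)) •
        TensorProduct.tmul QueerSuper.K (QueerSuper.tElt a c) (QueerSuper.tElt c b)) ∧
    (∀ (a b : QueerSuper.Idx n) (x y : QueerSuper.U n), (QueerSuper.tElt a b).1 (x * y) =
      ∑ c, (QueerSuper.tElt a c).1 x * (QueerSuper.tElt c b).1 y) := by
  open QueerSuper in
  exact ⟨isBisuperalgebra_finiteDual n, isSubBisuperalgebra_coordAlg n,
    fun a b => ⟨tElt_mem_coordAlg a b, tElt_mem_parityPart a b⟩, tElt_neg_neg, rtt n, comulFD_tElt,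
    tElt_apply_mul⟩
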